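/- **Conventions.** Let $n\ge 0$ be an integer, $z\cdot w=\sum_j z_jw_j$ and $z^2=z\cdot z$ for $z,w\in\mathbb C^n$, $|z|^2=\sum_j|z_j|^2$, let $\nu_m$ be Lebesgue measure on $\mathbb R^m$ (with $\mathbb C^n=\mathbb R^n\times\mathbb R^n$, $z=x+iy$), and $dg_n(z)=\pi^{-n}e^{-|z|^2}\,d\nu_{2n}(z)$. The Fock space $\mathcal F^2(\mathbb C^n)$ is the space of entire functions in $L_2(\mathbb C^n,dg_n)$. The Bargmann transform is $$(B^*g)(z)=\pi^{-n/4}\int_{\mathbb R^n}g(x)\,e^{\sqrt2\,x\cdot z-\frac{x^2}{2}-\frac{z^2}{2}}\,dx ,\qquad g\in L_2(\mathbb R^n),\ z\in\mathbb C^n ;$$ it is an isometric isomorphism from $L_2(\mathbb R^n)$ onto $\mathcal F^2(\mathbb C^n)\subset L_2(\mathbb C^n,dg_n)$, and $B\colon L_2(\mathbb C^n,dg_n)\to L_2(\mathbb R^n)$ denotes its adjoint. A complex Borel measure $\mu$ of locally finite variation (a countably additive complex function on the bounded Borel sets) on $\mathbb C^n$ is a Fock–Carleson measure if there is a constant $C>0$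 with $$\int_{\mathbb C^n}|f(w)|^2e^{-|w|^2}\,d|\mu|(w)\le C\,\|f\|^2\qquad\text{for all } f\in\mathcal F^2(\mathbb C^n),$$ where $|\mu|$ is the total variation of $\mu$. For such $\mu$ the Toeplitz operator $T_\mu$ on $\mathcal F^2(\mathbb C^n)$ is $$(T_\mu f)(z)=\pi^{-n}\int_{\mathbb C^n}e^{z\cdot\overline w}f(w)e^{-|w|^2}\,d\mu(w),\qquad z\in\mathbb C^n .$$ **Theorem.** Let $\varrho$ be a complex Borel measure of locally finite variation on $\mathbb R^n$ such that $\mu=\varrho\otimes\nu_n$ (that is, $\mu(X\times Y)=\varrho(X)\,\nu_n(Y)$ for bounded Borel sets $X,Y\subset\mathbb R^n$) is a Fock–Carleson measure. Then the integrals defining $T_\mu f$ converge absolutely for all $f\in\mathcal F^2(\mathbb C^n)$ and $z\in\mathbb C^n$, and $T_\mu$ is a bounded operator on $\mathcal F^2(\mathbb C^n)$. The integral $$\gamma_\varrho(x)=\left(\frac2\pi\right)^{n/2}\int_{\mathbb R^n}e^{-(x-\sqrt2\,y)^2}\,d\varrho(y)$$ converges absolutely for every $x\in\mathbb R^n$,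 and $\gamma_\varrho\in L_\infty(\mathbb R^n)$. Moreover $B\,T_\mu B^*=\gamma_\varrho\,\mathrm{Id}$ is the operator of multiplication by $\gamma_\varrho$ on $L_2(\mathbb R^n)$; as $B^*$ is unitary from $L_2(\mathbb R^n)$ onto $\mathcal F^2(\mathbb C^n)$, with inverse the restriction of $B$, the operator $T_\mu$ is unitarily equivalent to this multiplication operator. -/

import Mathlib

open MeasureTheory
open scoped ENNReal

noncomputable section

/-! ### Complex measures that are only locally finite -/

/-- A complex Borel measure of locally finite variation. Such a measure need not have a complex value
on an unbounded set (Lebesgue measure is an example), so it is a countably additive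
complex-valued function on the bounded Borel sets; what `toFun` does elsewhere is never used.
On `ℝⁿ` and `ℂⁿ` every such measure is regular. -/
structure LocalComplexMeasure (X : Type*) [NormedAddCommGroup X] [MeasurableSpace X] where
  toFun : Set X → ℂ
  hasSum_iUnion : ∀ A : ℕ → Set X, (∀ i, MeasurableSet (A i)) →
    Pairwise (Function.onFun Disjoint A) → Bornology.IsBounded (⋃ i, A i) →
    HasSum (fun i => toFun (A i)) (toFun (⋃ i, A i))

/-- The shell `{x : k ≤ ‖x‖ < k + 1}`; the shells with `k = 0, 1, 2, …` partition the space. -/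
def shell (X : Type*) [NormedAddCommGroup X] (k : ℕ) : Set X :=
  {x | (k : ℝ) ≤ ‖x‖ ∧ ‖x‖ < (k : ℝ) + 1}

theorem shell_measurableSet (X : Type*) [NormedAddCommGroup X] [MeasurableSpace X]
    [BorelSpace X] (k : ℕ) : MeasurableSet (shell X k) :=
  (measurableSet_le measurable_const measurable_norm).inter
    (measurableSet_lt measurable_norm measurable_const)

theorem shell_isBounded (X : Type*) [NormedAddCommGroup X] (k : ℕ) :
    Bornology.IsBounded (shell X k) :=
  isBounded_iff_forall_norm_le.2 ⟨(k : ℝ) + 1, fun _ hx => hx.2.le⟩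

namespace LocalComplexMeasure

theorem toFun_empty {X : Type*} [NormedAddCommGroup X] [MeasurableSpace X]
    (μ : LocalComplexMeasure X) : μ.toFun ∅ = 0 := by
  have h := μ.hasSum_iUnion (fun _ => ∅) (fun _ => MeasurableSet.empty)
    (fun _ _ _ => disjoint_bot_left) (by simp)
  exact tendsto_nhds_unique tendsto_const_nhds h.summable.tendsto_atTop_zero

open Classical in
/-- The (finite) complex measure `E ↦ μ (E ∩ S)`, for a bounded Borel set `S`. -/
def restrict {X : Type*} [NormedAddCommGroup X] [MeasurableSpace X]
    (μ : LocalComplexMeasure X) (S : Set X) (hS : MeasurableSet S)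
    (hb : Bornology.IsBounded S) : ComplexMeasure X where
  measureOf' E := if MeasurableSet E then μ.toFun (E ∩ S) else 0
  empty' := by simp [toFun_empty]
  not_measurable' _ hE := if_neg hE
  m_iUnion' A hA hd := by
    have h := μ.hasSum_iUnion (fun i => A i ∩ S) (fun i => (hA i).inter hS)
      (fun i j hij => (hd hij).mono Set.inter_subset_left Set.inter_subset_left)
      (hb.subset (Set.iUnion_subset fun _ => Set.inter_subset_right))
    rw [← Set.iUnion_inter] at h
    simpa only [if_pos (hA _), if_pos (MeasurableSet.iUnion hA)] using h

/-- The part of `μ` carried by the `k`-th shell. -/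
def onShell {X : Type*} [NormedAddCommGroup X] [MeasurableSpace X] [BorelSpace X]
    (μ : LocalComplexMeasure X) (k : ℕ) : ComplexMeasure X :=
  μ.restrict (shell X k) (shell_measurableSet X k) (shell_isBounded X k)

/-- The total variation `|μ|`, a positive measure. On each shell it is
the supremum of `∑ |μ (Eᵢ)|` over partitions. -/
def variation {X : Type*} [NormedAddCommGroup X] [MeasurableSpace X] [BorelSpace X]
    (μ : LocalComplexMeasure X) : Measure X :=
  Measure.sum fun k => (μ.onShell k).variation

/-- `(Re μ)⁺`, the positive part in the Jordan decomposition of the real part. -/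
def rePos {X : Type*} [NormedAddCommGroup X] [MeasurableSpace X] [BorelSpace X]
    (μ : LocalComplexMeasure X) : Measure X :=
  Measure.sum fun k => (ComplexMeasure.re (μ.onShell k)).toJordanDecomposition.posPart

/-- `(Re μ)⁻`. -/
def reNeg {X : Type*} [NormedAddCommGroup X] [MeasurableSpace X] [BorelSpace X]
    (μ : LocalComplexMeasure X) : Measure X :=
  Measure.sum fun k => (ComplexMeasure.re (μ.onShell k)).toJordanDecomposition.negPart

/-- `(Im μ)⁺`. -/
def imPos {X : Type*} [NormedAddCommGroup X] [MeasurableSpace X] [BorelSpace X]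
    (μ : LocalComplexMeasure X) : Measure X :=
  Measure.sum fun k => (ComplexMeasure.im (μ.onShell k)).toJordanDecomposition.posPart

/-- `(Im μ)⁻`. -/
def imNeg {X : Type*} [NormedAddCommGroup X] [MeasurableSpace X] [BorelSpace X]
    (μ : LocalComplexMeasure X) : Measure X :=
  Measure.sum fun k => (ComplexMeasure.im (μ.onShell k)).toJordanDecomposition.negPart

/-- The integral `∫ f dμ`, meaningful when `f` is integrable with respect to `|μ|`. -/
def integral {X : Type*} [NormedAddCommGroup X] [MeasurableSpace X] [BorelSpace X]
    (μ : LocalComplexMeasure X) (f : X → ℂ) : ℂ :=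
  ((∫ x, f x ∂μ.rePos) - ∫ x, f x ∂μ.reNeg) +
    Complex.I * ((∫ x, f x ∂μ.imPos) - ∫ x, f x ∂μ.imNeg)

end LocalComplexMeasure

/-! ### The Fock space -/

/-- `|z|² = ∑ |z_j|²`. -/
def sqNorm {n : ℕ} (z : Fin n → ℂ) : ℝ := ∑ j, ‖z j‖ ^ 2

/-- The Gaussian measure `π⁻ⁿ e^{-|z|²} dν_{2n}(z)` on `ℂⁿ`. -/
def fockGaussian (n : ℕ) : Measure (Fin n → ℂ) :=
  volume.withDensity fun z => ENNReal.ofReal ((Real.pi ^ n)⁻¹ * Real.exp (-sqNorm z))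

/-- `L₂(ℂⁿ, dg_n)`. -/
abbrev L2Gaussian (n : ℕ) := Lp (α := Fin n → ℂ) ℂ 2 (fockGaussian n)

/-- `L₂(ℝⁿ)`. -/
abbrev L2Real (n : ℕ) := Lp (α := Fin n → ℝ) ℂ 2 volume

/-- The Fock space: the (classes of) entire functions in `L₂(ℂⁿ, dg_n)`. -/
def Fock (n : ℕ) : Submodule ℂ (L2Gaussian n) where
  carrier := {F | ∃ f : (Fin n → ℂ) → ℂ, Differentiable ℂ f ∧ F =ᵐ[fockGaussian n] f}
  zero_mem' := ⟨0, differentiable_const 0, Lp.coeFn_zero _ _ _⟩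
  add_mem' := by
    rintro F G ⟨f, hf, hFf⟩ ⟨g, hg, hGg⟩
    exact ⟨f + g, hf.add hg, (Lp.coeFn_add F G).trans (hFf.add hGg)⟩
  smul_mem' := by
    rintro c F ⟨f, hf, hFf⟩
    exact ⟨c • f, hf.const_smul c, (Lp.coeFn_smul c F).trans (hFf.const_smul c)⟩

/-- The entire function representing an element of the Fock space. It is unique, because two
continuous functions that agree almost everywhere agree. -/
def fockEntire {n : ℕ} (f : Fock n) : (Fin n → ℂ) → ℂ := Classical.choose f.2

/-! ### Bargmann transform -/

/-- `π^{-n/4} ∫ g(x) e^{√2 x·z - x²/2 - z²/2} dx`. -/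
def bargmannIntegral {n : ℕ} (g : (Fin n → ℝ) → ℂ) (z : Fin n → ℂ) : ℂ :=
  ((Real.pi ^ (-(n : ℝ) / 4) : ℝ) : ℂ) *
    ∫ x : Fin n → ℝ, g x *
      Complex.exp ((Real.sqrt 2 : ℂ) * (∑ j, (x j : ℂ) * z j)
        - (∑ j, (x j : ℂ) ^ 2) / 2 - (∑ j, z j ^ 2) / 2)

/-- `U` is the operator `g ↦ bargmannIntegral g` from `L₂(ℝⁿ)` to the Fock space; this is `B*` with
its range as codomain. -/
def IsBargmann {n : ℕ} (U : L2Real n ≃ₗᵢ[ℂ] Fock n) : Prop :=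
  ∀ (g : L2Real n) (z : Fin n → ℂ), fockEntire (U g) z = bargmannIntegral g z

/-- `B* : L₂(ℝⁿ) → L₂(ℂⁿ, dg_n)`. -/
def bargmannStar {n : ℕ} (U : L2Real n ≃ₗᵢ[ℂ] Fock n) : L2Real n →L[ℂ] L2Gaussian n :=
  (Fock n).subtypeL ∘L (U.toContinuousLinearEquiv : L2Real n →L[ℂ] Fock n)

/-- `B : L₂(ℂⁿ, dg_n) → L₂(ℝⁿ)`, the adjoint of `B*`. -/
def bargmannAdjoint {n : ℕ} (U : L2Real n ≃ₗᵢ[ℂ] Fock n) : L2Gaussian n →L[ℂ] L2Real n :=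
  ContinuousLinearMap.adjoint (bargmannStar U)

/-! ### Fock–Carleson measures and Toeplitz operators -/

/-- `μ` is a Fock–Carleson measure:
`∫ |f|² e^{-|w|²} d|μ|(w) ≤ C ‖f‖²` for all `f` in the Fock space. -/
def IsFockCarleson {n : ℕ} (μ : LocalComplexMeasure (Fin n → ℂ)) : Prop :=
  ∃ C : ℝ, 0 < C ∧ ∀ f : Fock n,
    ∫⁻ w, ENNReal.ofReal (‖fockEntire f w‖ ^ 2 * Real.exp (-sqNorm w)) ∂μ.variation
      ≤ ENNReal.ofReal (C * ‖f‖ ^ 2)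

/-- `μ = ϱ ⊗ ν_n` under `ℂⁿ = ℝⁿ × ℝⁿ`, `z = x + iy`, where `ν_n` is Lebesgue measure. -/
def IsTensorLebesgue {n : ℕ} (μ : LocalComplexMeasure (Fin n → ℂ))
    (ϱ : LocalComplexMeasure (Fin n → ℝ)) : Prop :=
  ∀ A B : Set (Fin n → ℝ), MeasurableSet A → MeasurableSet B →
    Bornology.IsBounded A → Bornology.IsBounded B →
    μ.toFun {z | (fun j => (z j).re) ∈ A ∧ (fun j => (z j).im) ∈ B}
      = ϱ.toFun A * ((volume B).toReal : ℂ)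

/-- The integrand `w ↦ e^{z·w̄} f(w) e^{-|w|²}`. -/
def toeplitzIntegrand {n : ℕ} (f : (Fin n → ℂ) → ℂ) (z w : Fin n → ℂ) : ℂ :=
  Complex.exp (∑ j, z j * starRingEnd ℂ (w j)) * f w * (Real.exp (-sqNorm w) : ℂ)

/-- `T` is the bounded Toeplitz operator `T_μ` on the Fock space:
`(T f)(z) = π⁻ⁿ ∫ e^{z·w̄} f(w) e^{-|w|²} dμ(w)`, the integrals being absolutely convergent. -/
def IsToeplitz {n : ℕ} (μ : LocalComplexMeasure (Fin n → ℂ)) (T : Fock n →L[ℂ] Fock n) : Prop :=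
  ∀ (f : Fock n) (z : Fin n → ℂ),
    Integrable (toeplitzIntegrand (fockEntire f) z) μ.variation ∧
    fockEntire (T f) z = ((Real.pi ^ n)⁻¹ : ℂ) * μ.integral (toeplitzIntegrand (fockEntire f) z)

/-- `y ↦ e^{-(x - √2 y)²}`. -/
def spectralKernel {n : ℕ} (x y : Fin n → ℝ) : ℂ :=
  (Real.exp (-∑ j, (x j - Real.sqrt 2 * y j) ^ 2) : ℂ)

/-- `γ_ϱ(x) = (2/π)^{n/2} ∫ e^{-(x - √2 y)²} dϱ(y)`. -/
def spectralFunction {n : ℕ} (ϱ : LocalComplexMeasure (Fin n → ℝ)) (x : Fin n → ℝ) : ℂ :=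
  (((2 / Real.pi) ^ ((n : ℝ) / 2) : ℝ) : ℂ) * ϱ.integral (spectralKernel x)

/-- `M` is the operator on `L₂(ℝⁿ)` of multiplication by `φ`. -/
def IsMultiplicationBy {n : ℕ} (φ : (Fin n → ℝ) → ℂ) (M : L2Real n →L[ℂ] L2Real n) : Prop :=
  ∀ g : L2Real n, M g =ᵐ[volume] fun x => φ x * g x

end

/-! Write `w = x + iy` and let `b(z,t)` be the Bargmann kernel. Completing squares gives `e^{z·w̄}
b(w,t) e^{-|w|²} = b(z,t) e^{-(t-√2x)²} e^{(√2t-x-z+iy)²/2}`. Only the last factor contains `y`, and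
its Lebesgue integral in `y` is `(2π)^{n/2}`, whatever `z`, `t` and `x` are. After Fubini, `T_μ B*g`
is therefore the Bargmann transform of `γ_ϱ g`, the constant being `π^{-n}(2π)^{n/2} = (2/π)^{n/2}`.

Fubini and the boundedness of `γ_ϱ` rest on one consequence of the Carleson condition. Tested on the
reproducing kernel at a real point `a`, for which `|k_a(w)|² e^{-|w|²} = e^{|a|²} e^{-|w-a|²}`, it
bounds the averages `∫ e^{-(x-a)²} dσ(x)` uniformly in `a`, for each of the four Jordan parts `σ` of
`ϱ` (`IsFockCarleson.hasBoundedGaussianAverages`). This requires each Jordan part of `μ` to be the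
corresponding part of `ϱ` times Lebesgue measure (`eq_map_prod_volume`), which follows from
uniqueness of the Jordan decomposition.

Unitarity of the Bargmann transform is proved as well. The conjugated Bargmann kernels have the same
Gram matrix as the reproducing kernels and are total in `L₂(ℝⁿ)` by Fourier uniqueness. This gives
an isometry, and the reproducing property shows that it is onto the Fock space. -/

noncomputable section

/-! ### Uniqueness of the Jordan decomposition without finiteness -/

namespace MeasureTheory.Measure.MutuallySingular

variable {α : Type*} [MeasurableSpace α] {a b c d : Measure α}

/-- The measure `a` lives on a set where `b` vanishes, and there `a ≤ c + b` reads `a ≤ c`. The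
hypothesis is a sum because infinite measures cannot be subtracted. -/
theorem le_of_add_eq_add (hab : a ⟂ₘ b) (hcd : c ⟂ₘ d) (h : a + d = c + b) : a ≤ c := by
  obtain ⟨s, -, has, hbs⟩ := hab
  obtain ⟨t, -, hct, hdt⟩ := hcd
  have hle : a ≤ c + b := h ▸ Measure.le_add_right le_rfl
  refine Measure.le_iff.2 fun E _ => ?_
  have h1 : a (E ∩ sᶜ ∩ t) = 0 := by
    refine le_antisymm ((hle _).trans ?_) zero_le
    rw [Measure.add_apply, measure_mono_null Set.inter_subset_right hct,
      measure_mono_null (Set.inter_subset_left.trans Set.inter_subset_right) hbs, add_zero]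
  have h2 : a (E ∩ sᶜ) ≤ c E := by
    refine (hle _).trans ?_
    rw [Measure.add_apply, measure_mono_null Set.inter_subset_right hbs, add_zero]
    exact measure_mono Set.inter_subset_left
  calc a E ≤ a ((E ∩ sᶜ) ∪ s) := measure_mono fun x hx => by
        by_cases hs : x ∈ s
        · exact Or.inr hs
        · exact Or.inl ⟨hx, hs⟩
    _ ≤ a (E ∩ sᶜ) + a s := measure_union_le _ _
    _ ≤ c E := by rw [has, add_zero]; exact h2

/-- The Jordan decomposition is unique, also for measures which are not finite. -/
theorem eq_and_eq_of_add_eq_add (hab : a ⟂ₘ b) (hcd : c ⟂ₘ d) (h : a + d = c + b) :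
    a = c ∧ b = d := by
  have h' : b + c = d + a := by rw [add_comm b, add_comm d, h]
  exact ⟨le_antisymm (hab.le_of_add_eq_add hcd h) (hcd.le_of_add_eq_add hab h.symm),
    le_antisymm (hab.symm.le_of_add_eq_add hcd.symm h')
      (hcd.symm.le_of_add_eq_add hab.symm h'.symm)⟩

theorem prod {β : Type*} [MeasurableSpace β] (hab : a ⟂ₘ b) (m : Measure β) [SFinite m] :
    a.prod m ⟂ₘ b.prod m := by
  obtain ⟨s, hs, has, hbs⟩ := hab
  refine ⟨s ×ˢ Set.univ, hs.prod MeasurableSet.univ, ?_, ?_⟩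
  · simp [has]
  · have : (s ×ˢ (Set.univ : Set β))ᶜ = sᶜ ×ˢ Set.univ := by ext; simp
    rw [this]
    simp [hbs]

end MeasureTheory.Measure.MutuallySingular

/-! ### Measures assembled from shells -/

section Shells

variable {X : Type*} [NormedAddCommGroup X]

theorem pairwise_disjoint_shell : Pairwise (Function.onFun Disjoint (shell X)) := by
  intro j k hjk
  refine Set.disjoint_left.2 fun x hj hk => hjk ?_
  have h1 : (j : ℝ) < k + 1 := hj.1.trans_lt hk.2
  have h2 : (k : ℝ) < j + 1 := hk.1.trans_lt hj.2
  norm_cast at h1 h2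
  omega

theorem iUnion_shell : ⋃ k, shell X k = Set.univ := by
  refine Set.eq_univ_of_forall fun x => Set.mem_iUnion.2 ⟨⌊‖x‖⌋₊, ?_, ?_⟩
  · exact Nat.floor_le (norm_nonneg x)
  · exact Nat.lt_floor_add_one _

theorem exists_forall_disjoint_shell {E : Set X} (hE : Bornology.IsBounded E) :
    ∃ K : ℕ, ∀ k, K ≤ k → Disjoint E (shell X k) := by
  obtain ⟨R, hR⟩ := isBounded_iff_forall_norm_le.1 hE
  obtain ⟨K, hK⟩ := exists_nat_gt R
  refine ⟨K, fun k hk => Set.disjoint_left.2 fun x hx hs => ?_⟩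
  have h1 := hR x hx
  have h2 := hs.1
  have h3 : (K : ℝ) ≤ k := by exact_mod_cast hk
  linarith

variable [MeasurableSpace X]

/-- `s k` is carried by the `k`-th shell. -/
def CarriedByShells (s : ℕ → SignedMeasure X) : Prop :=
  ∀ k E, MeasurableSet E → Disjoint E (shell X k) → s k E = 0

variable {s : ℕ → SignedMeasure X}

theorem CarriedByShells.totalVariation_eq_zero (hs : CarriedByShells s) {k : ℕ} {E : Set X}
    (hE : MeasurableSet E) (hd : Disjoint E (shell X k)) : (s k).totalVariation E = 0 := by
  rw [SignedMeasure.totalVariation_eq_variation, VectorMeasure.variation_apply_eq_zero hE]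
  exact fun t ht htm => hs k t htm (hd.mono_left ht)

theorem CarriedByShells.posPart_eq_zero (hs : CarriedByShells s) {k : ℕ} {E : Set X}
    (hE : MeasurableSet E) (hd : Disjoint E (shell X k)) :
    (s k).toJordanDecomposition.posPart E = 0 :=
  le_antisymm ((Measure.le_add_right le_rfl : _ ≤ (s k).totalVariation) E |>.trans
    (hs.totalVariation_eq_zero hE hd).le) zero_le

theorem CarriedByShells.negPart_eq_zero (hs : CarriedByShells s) {k : ℕ} {E : Set X}
    (hE : MeasurableSet E) (hd : Disjoint E (shell X k)) :
    (s k).toJordanDecomposition.negPart E = 0 :=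
  le_antisymm ((Measure.le_add_left le_rfl : _ ≤ (s k).totalVariation) E |>.trans
    (hs.totalVariation_eq_zero hE hd).le) zero_le

/-- Parts from one shell are singular by the Jordan decomposition there; parts from different shells
have disjoint carriers. -/
theorem CarriedByShells.mutuallySingular [BorelSpace X] (hs : CarriedByShells s) :
    Measure.sum (fun k => (s k).toJordanDecomposition.posPart) ⟂ₘ
      Measure.sum (fun k => (s k).toJordanDecomposition.negPart) := by
  refine Measure.MutuallySingular.sum_left.2 fun j => Measure.MutuallySingular.sum_right.2
    fun k => ?_
  rcases eq_or_ne j k with rfl | hjk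
  · exact (s j).toJordanDecomposition.mutuallySingular
  · refine ⟨(shell X j)ᶜ, (shell_measurableSet X j).compl,
      hs.posPart_eq_zero (shell_measurableSet X j).compl disjoint_compl_left, ?_⟩
    rw [compl_compl]
    exact hs.negPart_eq_zero (shell_measurableSet X j) (pairwise_disjoint_shell hjk)

/-- A bounded set meets only finitely many shells, and each summand is finite. -/
theorem sum_apply_lt_top_of_isBounded {m : ℕ → Measure X} [∀ k, IsFiniteMeasure (m k)]
    (hm : ∀ k E, MeasurableSet E → Disjoint E (shell X k) → m k E = 0) {E : Set X}
    (hE : MeasurableSet E) (hb : Bornology.IsBounded E) : Measure.sum m E < ∞ := by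
  obtain ⟨K, hK⟩ := exists_forall_disjoint_shell hb
  rw [Measure.sum_apply _ hE, tsum_eq_sum (s := Finset.range K) fun k hk =>
    hm k E hE (hK k (by simpa using hk))]
  exact ENNReal.sum_lt_top.2 fun k _ => measure_lt_top _ _

theorem hasSum_toReal_sum_apply {m : ℕ → Measure X} [∀ k, IsFiniteMeasure (m k)]
    (hm : ∀ k E, MeasurableSet E → Disjoint E (shell X k) → m k E = 0) {E : Set X}
    (hE : MeasurableSet E) (hb : Bornology.IsBounded E) :
    HasSum (fun k => (m k).real E) ((Measure.sum m).real E) := by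
  have h := (sum_apply_lt_top_of_isBounded hm hE hb).ne
  rw [measureReal_def]
  rw [Measure.sum_apply _ hE] at h ⊢
  rw [ENNReal.tsum_toReal_eq fun k => measure_ne_top (m k) E]
  exact ENNReal.hasSum_toReal h

theorem CarriedByShells.hasSum (hs : CarriedByShells s) {E : Set X}
    (hE : MeasurableSet E) (hb : Bornology.IsBounded E) :
    HasSum (fun k => s k E)
      ((Measure.sum fun k => (s k).toJordanDecomposition.posPart).real E -
        (Measure.sum fun k => (s k).toJordanDecomposition.negPart).real E) := by
  have h := (hasSum_toReal_sum_apply (fun _ _ => hs.posPart_eq_zero) hE hb).sub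
    (hasSum_toReal_sum_apply (fun _ _ => hs.negPart_eq_zero) hE hb)
  simpa only [SignedMeasure.apply_eq_posPart_real_sub_negPart_real _ hE] using h

end Shells

/-! ### Jordan parts and total variation of a locally finite complex measure -/

namespace LocalComplexMeasure

section Variation

variable {X : Type*} [MeasurableSpace X]

theorem totalVariation_re_le (c : ComplexMeasure X) :
    (ComplexMeasure.re c).totalVariation ≤ c.variation := by
  rw [SignedMeasure.totalVariation_eq_variation]
  refine VectorMeasure.variation_le_of_forall_enorm_le fun E _ => ?_
  refine le_trans ?_ (VectorMeasure.enorm_measure_le_variation c E)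
  rw [enorm_le_iff_norm_le]
  exact Complex.abs_re_le_norm (c E)

theorem totalVariation_im_le (c : ComplexMeasure X) :
    (ComplexMeasure.im c).totalVariation ≤ c.variation := by
  rw [SignedMeasure.totalVariation_eq_variation]
  refine VectorMeasure.variation_le_of_forall_enorm_le fun E _ => ?_
  refine le_trans ?_ (VectorMeasure.enorm_measure_le_variation c E)
  rw [enorm_le_iff_norm_le]
  exact Complex.abs_im_le_norm (c E)

theorem variation_le_totalVariation (c : ComplexMeasure X) :
    c.variation ≤ (ComplexMeasure.re c).totalVariation + (ComplexMeasure.im c).totalVariation := by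
  refine VectorMeasure.variation_le_of_forall_enorm_le fun E _ => ?_
  rw [Measure.add_apply]
  have h : ‖c E‖ₑ ≤ ‖(c E).re‖ₑ + ‖(c E).im‖ₑ := by
    rw [← ofReal_norm, ← ofReal_norm, ← ofReal_norm,
      ← ENNReal.ofReal_add (norm_nonneg _) (norm_nonneg _)]
    exact ENNReal.ofReal_le_ofReal (Complex.norm_le_abs_re_add_abs_im _)
  exact h.trans (add_le_add ((ComplexMeasure.re c).enorm_le_totalVariation E)
    ((ComplexMeasure.im c).enorm_le_totalVariation E))

theorem sum_mono {ι : Type*} {m m' : ι → Measure X} (h : ∀ i, m i ≤ m' i) :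
    Measure.sum m ≤ Measure.sum m' := by
  refine Measure.le_iff.2 fun E hE => ?_
  rw [Measure.sum_apply _ hE, Measure.sum_apply _ hE]
  exact ENNReal.tsum_le_tsum fun i => h i E

end Variation

variable {X : Type*} [NormedAddCommGroup X] [MeasurableSpace X] [BorelSpace X]
  (μ : LocalComplexMeasure X)

theorem onShell_apply (k : ℕ) {E : Set X} (hE : MeasurableSet E) :
    μ.onShell k E = μ.toFun (E ∩ shell X k) := if_pos hE

theorem carriedByShells_re : CarriedByShells fun k => ComplexMeasure.re (μ.onShell k) := by
  intro k E hE hd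
  change (μ.onShell k E).re = 0
  rw [μ.onShell_apply k hE, hd.inter_eq, toFun_empty, Complex.zero_re]

theorem carriedByShells_im : CarriedByShells fun k => ComplexMeasure.im (μ.onShell k) := by
  intro k E hE hd
  change (μ.onShell k E).im = 0
  rw [μ.onShell_apply k hE, hd.inter_eq, toFun_empty, Complex.zero_im]

theorem hasSum_onShell {E : Set X} (hE : MeasurableSet E) (hb : Bornology.IsBounded E) :
    HasSum (fun k => μ.onShell k E) (μ.toFun E) := by
  have h := μ.hasSum_iUnion (fun k => E ∩ shell X k)
    (fun k => hE.inter (shell_measurableSet X k))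
    (fun i j hij => (pairwise_disjoint_shell hij).mono Set.inter_subset_right
      Set.inter_subset_right)
    (hb.subset (Set.iUnion_subset fun _ => Set.inter_subset_left))
  rw [← Set.inter_iUnion, iUnion_shell, Set.inter_univ] at h
  simpa only [μ.onShell_apply _ hE] using h

theorem rePos_sub_reNeg {E : Set X} (hE : MeasurableSet E) (hb : Bornology.IsBounded E) :
    μ.rePos.real E - μ.reNeg.real E = (μ.toFun E).re :=
  (μ.carriedByShells_re.hasSum hE hb).unique (Complex.hasSum_re (μ.hasSum_onShell hE hb))

theorem imPos_sub_imNeg {E : Set X} (hE : MeasurableSet E) (hb : Bornology.IsBounded E) :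
    μ.imPos.real E - μ.imNeg.real E = (μ.toFun E).im :=
  (μ.carriedByShells_im.hasSum hE hb).unique (Complex.hasSum_im (μ.hasSum_onShell hE hb))

theorem rePos_mutuallySingular : μ.rePos ⟂ₘ μ.reNeg := μ.carriedByShells_re.mutuallySingular

theorem imPos_mutuallySingular : μ.imPos ⟂ₘ μ.imNeg := μ.carriedByShells_im.mutuallySingular

instance : SFinite μ.rePos := by unfold rePos; infer_instance
instance : SFinite μ.reNeg := by unfold reNeg; infer_instance
instance : SFinite μ.imPos := by unfold imPos; infer_instance
instance : SFinite μ.imNeg := by unfold imNeg; infer_instance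

theorem rePos_lt_top {E : Set X} (hE : MeasurableSet E) (hb : Bornology.IsBounded E) :
    μ.rePos E < ∞ :=
  sum_apply_lt_top_of_isBounded (fun _ _ => μ.carriedByShells_re.posPart_eq_zero) hE hb

theorem reNeg_lt_top {E : Set X} (hE : MeasurableSet E) (hb : Bornology.IsBounded E) :
    μ.reNeg E < ∞ :=
  sum_apply_lt_top_of_isBounded (fun _ _ => μ.carriedByShells_re.negPart_eq_zero) hE hb

theorem imPos_lt_top {E : Set X} (hE : MeasurableSet E) (hb : Bornology.IsBounded E) :
    μ.imPos E < ∞ :=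
  sum_apply_lt_top_of_isBounded (fun _ _ => μ.carriedByShells_im.posPart_eq_zero) hE hb

theorem imNeg_lt_top {E : Set X} (hE : MeasurableSet E) (hb : Bornology.IsBounded E) :
    μ.imNeg E < ∞ :=
  sum_apply_lt_top_of_isBounded (fun _ _ => μ.carriedByShells_im.negPart_eq_zero) hE hb

theorem rePos_le_variation : μ.rePos ≤ μ.variation :=
  sum_mono fun _ => le_trans (Measure.le_add_right le_rfl) (totalVariation_re_le _)

theorem reNeg_le_variation : μ.reNeg ≤ μ.variation :=
  sum_mono fun _ => le_trans (Measure.le_add_left le_rfl) (totalVariation_re_le _)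

theorem imPos_le_variation : μ.imPos ≤ μ.variation :=
  sum_mono fun _ => le_trans (Measure.le_add_right le_rfl) (totalVariation_im_le _)

theorem imNeg_le_variation : μ.imNeg ≤ μ.variation :=
  sum_mono fun _ => le_trans (Measure.le_add_left le_rfl) (totalVariation_im_le _)

/-- Reduces integrability against the variation to integrability against the four Jordan parts. -/
theorem variation_le : μ.variation ≤ μ.rePos + μ.reNeg + (μ.imPos + μ.imNeg) := by
  refine (sum_mono fun k => variation_le_totalVariation (μ.onShell k)).trans (le_of_eq ?_)
  simp only [rePos, reNeg, imPos, imNeg, Measure.sum_add_sum, SignedMeasure.totalVariation]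

end LocalComplexMeasure

/-! ### Jordan parts of a product with Lebesgue measure -/

/-- The identification `ℝⁿ × ℝⁿ ≃ ℂⁿ`, `(x, y) ↦ x + iy`. -/
def realProdEquivComplex (n : ℕ) : (Fin n → ℝ) × (Fin n → ℝ) ≃ᵐ (Fin n → ℂ) where
  toFun p j := ⟨p.1 j, p.2 j⟩
  invFun z := (fun j => (z j).re, fun j => (z j).im)
  left_inv _ := rfl
  right_inv _ := rfl
  measurable_toFun := by
    refine measurable_pi_lambda _ fun j => ?_
    exact Complex.measurableEquivRealProd.symm.measurable.comp
      (f := fun p : (Fin n → ℝ) × (Fin n → ℝ) => (p.1 j, p.2 j)) (((measurable_pi_apply j).comp measurable_fst).prodMk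
        ((measurable_pi_apply j).comp measurable_snd))
  measurable_invFun := by
    refine Measurable.prodMk ?_ ?_
    · exact measurable_pi_lambda _ fun j => Complex.measurable_re.comp (measurable_pi_apply j)
    · exact measurable_pi_lambda _ fun j => Complex.measurable_im.comp (measurable_pi_apply j)

theorem isBounded_rectangle {n : ℕ} {A B : Set (Fin n → ℝ)} (hA : Bornology.IsBounded A)
    (hB : Bornology.IsBounded B) :
    Bornology.IsBounded {z : Fin n → ℂ | (fun j => (z j).re) ∈ A ∧ (fun j => (z j).im) ∈ B} := by
  obtain ⟨a, ha⟩ := isBounded_iff_forall_norm_le.1 hA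
  obtain ⟨b, hb⟩ := isBounded_iff_forall_norm_le.1 hB
  refine isBounded_iff_forall_norm_le.2 ⟨a + b, fun z hz => ?_⟩
  have ha' := ha _ hz.1
  have hb' := hb _ hz.2
  refine (pi_norm_le_iff_of_nonneg
    (add_nonneg ((norm_nonneg _).trans ha') ((norm_nonneg _).trans hb'))).2 fun j => ?_
  exact (Complex.norm_le_abs_re_add_abs_im _).trans
    (add_le_add ((norm_le_pi_norm (fun j => (z j).re) j).trans ha')
      ((norm_le_pi_norm (fun j => (z j).im) j).trans hb'))

theorem measurableSet_rectangle {n : ℕ} {A B : Set (Fin n → ℝ)} (hA : MeasurableSet A)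
    (hB : MeasurableSet B) :
    MeasurableSet {z : Fin n → ℂ | (fun j => (z j).re) ∈ A ∧ (fun j => (z j).im) ∈ B} :=
  (realProdEquivComplex n).symm.measurable (hA.prod hB)

/-- Two mutually singular measures on `ℂⁿ` whose difference is a product with Lebesgue measure on
bounded rectangles are themselves products. -/
theorem eq_map_prod_volume {n : ℕ} {P' N' : Measure (Fin n → ℂ)} {P N : Measure (Fin n → ℝ)}
    [SFinite P] [SFinite N] (h' : P' ⟂ₘ N') (h : P ⟂ₘ N)
    (hP' : ∀ E, MeasurableSet E → Bornology.IsBounded E → P' E < ∞)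
    (hN' : ∀ E, MeasurableSet E → Bornology.IsBounded E → N' E < ∞)
    (hP : ∀ E, MeasurableSet E → Bornology.IsBounded E → P E < ∞)
    (hN : ∀ E, MeasurableSet E → Bornology.IsBounded E → N E < ∞)
    (heq : ∀ A B : Set (Fin n → ℝ), MeasurableSet A → MeasurableSet B →
      Bornology.IsBounded A → Bornology.IsBounded B →
      P'.real {z | (fun j => (z j).re) ∈ A ∧ (fun j => (z j).im) ∈ B} -
        N'.real {z | (fun j => (z j).re) ∈ A ∧ (fun j => (z j).im) ∈ B} =
      (P.real A - N.real A) * (volume B).toReal) :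
    P' = (P.prod volume).map (realProdEquivComplex n) ∧
      N' = (N.prod volume).map (realProdEquivComplex n) := by
  set e := realProdEquivComplex n with he
  -- The identity `P' - N' = (P - N) ⊗ volume`, rearranged into sums so that it makes sense for
  -- infinite measures.
  have key : P'.map e.symm + N.prod volume = P.prod volume + N'.map e.symm := by
    have hcov : ⋃ R : ℕ, Metric.closedBall (0 : Fin n → ℝ) R ×ˢ
        Metric.closedBall (0 : Fin n → ℝ) R = Set.univ := by
      refine Set.eq_univ_of_forall fun p => ?_
      obtain ⟨R, hR⟩ := exists_nat_ge (max ‖p.1‖ ‖p.2‖)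
      exact Set.mem_iUnion.2 ⟨R, by simpa using (le_max_left _ _).trans hR,
        by simpa using (le_max_right _ _).trans hR⟩
    refine Measure.ext_of_iUnion_eq_univ hcov fun R => ?_
    set K := Metric.closedBall (0 : Fin n → ℝ) R
    have hKm : MeasurableSet K := Metric.isClosed_closedBall.measurableSet
    have hKb : Bornology.IsBounded K := Metric.isBounded_closedBall
    have hfin : ∀ A B : Set (Fin n → ℝ), MeasurableSet A → MeasurableSet B →
      Bornology.IsBounded A → Bornology.IsBounded B →
        (P'.map e.symm + N.prod volume : Measure _) (A ×ˢ B) < ∞ := by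
      intro A B hA hB hAb hBb
      rw [Measure.add_apply, Measure.prod_prod, e.symm.map_apply]
      exact ENNReal.add_lt_top.2 ⟨hP' _ (measurableSet_rectangle hA hB)
        (isBounded_rectangle hAb hBb), ENNReal.mul_lt_top (hN A hA hAb) hBb.measure_lt_top⟩
    -- Finite measures on a product are determined by rectangles; hence the restriction to the
    -- bounded sets `K ×ˢ K`, which exhaust the space.
    have : IsFiniteMeasure ((P'.map e.symm + N.prod volume).restrict (K ×ˢ K)) :=
      ⟨by rw [Measure.restrict_apply_univ]; exact hfin K K hKm hKm hKb hKb⟩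
    refine Measure.ext_prod fun {s t} hs ht => ?_
    rw [Measure.restrict_apply (hs.prod ht), Measure.restrict_apply (hs.prod ht),
      Set.prod_inter_prod]
    have hA := hs.inter hKm
    have hB := ht.inter hKm
    have hAb := hKb.subset (Set.inter_subset_right (s := s))
    have hBb := hKb.subset (Set.inter_subset_right (s := t))
    generalize s ∩ K = A at *
    generalize t ∩ K = B at *
    have h1 := heq A B hA hB hAb hBb
    have hm := measurableSet_rectangle hA hB
    have hb := isBounded_rectangle hAb hBb
    rw [Measure.add_apply, Measure.add_apply, Measure.prod_prod, Measure.prod_prod,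
      e.symm.map_apply, e.symm.map_apply]
    change P' {z | (fun j => (z j).re) ∈ A ∧ (fun j => (z j).im) ∈ B} + _ =
      _ + N' {z | (fun j => (z j).re) ∈ A ∧ (fun j => (z j).im) ∈ B}
    have f1 := (hP' _ hm hb).ne
    have f2 := (hN' _ hm hb).ne
    have f3 := (ENNReal.mul_lt_top (hP A hA hAb) (hBb.measure_lt_top (μ := volume))).ne
    have f4 := (ENNReal.mul_lt_top (hN A hA hAb) (hBb.measure_lt_top (μ := volume))).ne
    rw [← ENNReal.toReal_eq_toReal_iff' (ENNReal.add_ne_top.2 ⟨f1, f4⟩)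
      (ENNReal.add_ne_top.2 ⟨f3, f2⟩), ENNReal.toReal_add f1 f4, ENNReal.toReal_add f3 f2,
      ENNReal.toReal_mul, ENNReal.toReal_mul]
    simp only [measureReal_def] at h1
    linarith
  have hsing : P'.map e.symm ⟂ₘ N'.map e.symm :=
    e.symm.measurableEmbedding.mutuallySingular_map h'
  obtain ⟨h1, h2⟩ := hsing.eq_and_eq_of_add_eq_add (h.prod volume) key
  rw [← h1, ← h2]
  simp

section Tensor

variable {n : ℕ} {μ : LocalComplexMeasure (Fin n → ℂ)} {ϱ : LocalComplexMeasure (Fin n → ℝ)}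

theorem IsTensorLebesgue.re_eq (h : IsTensorLebesgue μ ϱ) :
    μ.rePos = (ϱ.rePos.prod volume).map (realProdEquivComplex n) ∧
      μ.reNeg = (ϱ.reNeg.prod volume).map (realProdEquivComplex n) := by
  refine eq_map_prod_volume μ.rePos_mutuallySingular ϱ.rePos_mutuallySingular
    (fun _ => μ.rePos_lt_top) (fun _ => μ.reNeg_lt_top) (fun _ => ϱ.rePos_lt_top)
    (fun _ => ϱ.reNeg_lt_top) fun A B hA hB hAb hBb => ?_
  rw [μ.rePos_sub_reNeg (measurableSet_rectangle hA hB) (isBounded_rectangle hAb hBb),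
    ϱ.rePos_sub_reNeg hA hAb, h A B hA hB hAb hBb, Complex.re_mul_ofReal]

theorem IsTensorLebesgue.im_eq (h : IsTensorLebesgue μ ϱ) :
    μ.imPos = (ϱ.imPos.prod volume).map (realProdEquivComplex n) ∧
      μ.imNeg = (ϱ.imNeg.prod volume).map (realProdEquivComplex n) := by
  refine eq_map_prod_volume μ.imPos_mutuallySingular ϱ.imPos_mutuallySingular
    (fun _ => μ.imPos_lt_top) (fun _ => μ.imNeg_lt_top) (fun _ => ϱ.imPos_lt_top)
    (fun _ => ϱ.imNeg_lt_top) fun A B hA hB hAb hBb => ?_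
  rw [μ.imPos_sub_imNeg (measurableSet_rectangle hA hB) (isBounded_rectangle hAb hBb),
    ϱ.imPos_sub_imNeg hA hAb, h A B hA hB hAb hBb, Complex.im_mul_ofReal]

end Tensor

/-! ### The Gaussian measure and the mean value property -/

section Gaussian

variable {n : ℕ}

theorem ofReal_sqNorm (z : Fin n → ℂ) : (sqNorm z : ℂ) = ∑ j, z j * starRingEnd ℂ (z j) := by
  simp [sqNorm, Complex.mul_conj, Complex.normSq_eq_norm_sq]

theorem continuous_sqNorm : Continuous (sqNorm : (Fin n → ℂ) → ℝ) := by
  unfold sqNorm; fun_prop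

theorem exp_neg_sqNorm (z : Fin n → ℂ) : Real.exp (-sqNorm z) = ∏ j, Real.exp (-‖z j‖ ^ 2) := by
  rw [← Real.exp_sum, sqNorm, Finset.sum_neg_distrib]

theorem integrable_exp_neg_norm_sq : Integrable fun z : ℂ => Real.exp (-‖z‖ ^ 2) := by
  have h := GaussianFourier.integrable_cexp_neg_mul_sq_norm_add (V := ℂ) (b := 1) (by simp) 0 0
  refine h.norm.congr (Filter.Eventually.of_forall fun z => ?_)
  simp [Complex.norm_exp, ← Complex.ofReal_pow]

theorem integral_exp_neg_norm_sq : ∫ z : ℂ, Real.exp (-‖z‖ ^ 2) = Real.pi := by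
  have h := GaussianFourier.integral_rexp_neg_mul_sq_norm (V := ℂ) (b := 1) one_pos
  simpa using h

theorem integrable_exp_neg_sqNorm : Integrable fun z : Fin n → ℂ => Real.exp (-sqNorm z) := by
  simp_rw [exp_neg_sqNorm]
  exact Integrable.fintype_prod fun _ => integrable_exp_neg_norm_sq

theorem integral_exp_neg_sqNorm : ∫ z : Fin n → ℂ, Real.exp (-sqNorm z) = Real.pi ^ n := by
  simp_rw [exp_neg_sqNorm]
  rw [integral_fintype_prod_volume_eq_pow (fun z : ℂ => Real.exp (-‖z‖ ^ 2)),
    integral_exp_neg_norm_sq, Fintype.card_fin]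

theorem measurable_fockDensity :
    Measurable fun z : Fin n → ℂ => (Real.pi ^ n)⁻¹ * Real.exp (-sqNorm z) :=
  (continuous_const.mul (Real.continuous_exp.comp continuous_sqNorm.neg)).measurable

theorem integrable_fockGaussian_iff {F : (Fin n → ℂ) → ℂ} :
    Integrable F (fockGaussian n) ↔
      Integrable fun z => F z * (Real.exp (-sqNorm z) : ℂ) := by
  unfold fockGaussian
  rw [integrable_withDensity_iff_integrable_smul' measurable_fockDensity.ennreal_ofReal
    (Filter.Eventually.of_forall fun _ => ENNReal.ofReal_lt_top)]
  refine Iff.trans ?_ (integrable_const_mul_iff (c := ((Real.pi ^ n)⁻¹ : ℂ))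
    (IsUnit.mk0 _ (inv_ne_zero (pow_ne_zero _ (by exact_mod_cast Real.pi_ne_zero)))) _)
  refine integrable_congr (Filter.Eventually.of_forall fun z => ?_)
  simp only
  rw [ENNReal.toReal_ofReal (by positivity), Complex.real_smul]
  push_cast
  ring

theorem integral_fockGaussian (F : (Fin n → ℂ) → ℂ) :
    ∫ z, F z ∂fockGaussian n =
      ((Real.pi ^ n)⁻¹ : ℂ) * ∫ z, F z * (Real.exp (-sqNorm z) : ℂ) := by
  unfold fockGaussian
  rw [integral_withDensity_eq_integral_toReal_smul measurable_fockDensity.ennreal_ofReal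
    (Filter.Eventually.of_forall fun _ => ENNReal.ofReal_lt_top), ← integral_const_mul]
  refine integral_congr_ae (Filter.Eventually.of_forall fun z => ?_)
  simp only
  rw [ENNReal.toReal_ofReal (by positivity), Complex.real_smul]
  push_cast
  ring

instance isProbabilityMeasure_fockGaussian : IsProbabilityMeasure (fockGaussian n) := by
  constructor
  unfold fockGaussian
  rw [withDensity_apply _ MeasurableSet.univ, setLIntegral_univ,
    ← ofReal_integral_eq_lintegral_ofReal (integrable_exp_neg_sqNorm.const_mul _)
      (Filter.Eventually.of_forall fun _ => by positivity),
    integral_const_mul, integral_exp_neg_sqNorm, inv_mul_cancel₀ (by positivity), ENNReal.ofReal_one]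

theorem volume_absolutelyContinuous_fockGaussian :
    (volume : Measure (Fin n → ℂ)) ≪ fockGaussian n :=
  withDensity_absolutelyContinuous' measurable_fockDensity.ennreal_ofReal.aemeasurable
    (Filter.Eventually.of_forall fun z => by
      rw [Ne, ENNReal.ofReal_eq_zero, not_le]; positivity)

theorem eq_of_ae_eq_fockGaussian {f g : (Fin n → ℂ) → ℂ} (hf : Continuous f) (hg : Continuous g)
    (h : f =ᵐ[fockGaussian n] g) : f = g :=
  (Continuous.ae_eq_iff_eq volume hf hg).1 (volume_absolutelyContinuous_fockGaussian.ae_eq h)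

theorem measurePreserving_smul_fockGaussian {c : ℂ} (hc : ‖c‖ = 1) :
    MeasurePreserving (fun z : Fin n → ℂ => c • z) (fockGaussian n) (fockGaussian n) := by
  have hvol : MeasurePreserving (fun z : Fin n → ℂ => c • z) volume volume := by
    have h := volume_preserving_pi (ι := Fin n) fun _ =>
      (rotation ⟨c, mem_sphere_zero_iff_norm.2 hc⟩ : ℂ ≃ₗᵢ[ℝ] ℂ).measurePreserving
    exact h
  refine ⟨hvol.measurable, ?_⟩
  have hs : ∀ z : Fin n → ℂ, sqNorm (c • z) = sqNorm z := fun z => by simp [sqNorm, hc]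
  ext E hE
  rw [Measure.map_apply hvol.measurable hE, fockGaussian, withDensity_apply _ hE,
    withDensity_apply _ (hvol.measurable hE), ← hvol.setLIntegral_comp_preimage hE
      measurable_fockDensity.ennreal_ofReal]
  simp only [hs]

/-- Mean value property of entire functions on `ℂⁿ` with respect to the Gaussian measure. -/
theorem integral_fockGaussian_of_differentiable {f : (Fin n → ℂ) → ℂ} (hf : Differentiable ℂ f)
    (hi : Integrable f (fockGaussian n)) : ∫ z, f z ∂fockGaussian n = f 0 := by
  -- Average `f (e^{iθ} z)` over both `θ` and `z`. For fixed `θ`, rotation invariance gives the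
  -- Gaussian integral of `f`; for fixed `z`, the one-variable entire function `c ↦ f (c • z)` has
  -- circle average `f 0`.
  set I : Measure ℝ := volume.restrict (Set.Ioc 0 (2 * Real.pi))
  have hnorm : ∀ θ : ℝ, ‖circleMap 0 1 θ‖ = 1 := fun θ => by simp
  have hmp := fun θ : ℝ => measurePreserving_smul_fockGaussian (n := n) (hnorm θ)
  have hemb := fun θ : ℝ => (measurableEmbedding_const_smul₀ (α := Fin n → ℂ)
    (norm_ne_zero_iff.1 ((hnorm θ).trans_ne one_ne_zero)))
  have hcont : Continuous fun p : ℝ × (Fin n → ℂ) => f (circleMap 0 1 p.1 • p.2) :=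
    hf.continuous.comp (((continuous_circleMap 0 1).comp continuous_fst).smul continuous_snd)
  have hint : Integrable (fun p : ℝ × (Fin n → ℂ) => f (circleMap 0 1 p.1 • p.2))
      (I.prod (fockGaussian n)) := by
    refine (integrable_prod_iff hcont.aestronglyMeasurable).2
      ⟨Filter.Eventually.of_forall fun θ => (hmp θ).integrable_comp_of_integrable hi, ?_⟩
    have : (fun θ : ℝ => ∫ z, ‖f (circleMap 0 1 θ • z)‖ ∂fockGaussian n) =
        fun _ => ∫ z, ‖f z‖ ∂fockGaussian n :=
      funext fun θ => (hmp θ).integral_comp (hemb θ) fun z => ‖f z‖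
    rw [this]
    exact integrable_const _
  have havg : ∀ z, ∫ θ, f (circleMap 0 1 θ • z) ∂I = (2 * Real.pi) • f 0 := by
    intro z
    have hd : Differentiable ℂ fun c : ℂ => f (c • z) :=
      hf.comp (differentiable_id.smul_const z)
    have h := (hd.diffContOnCl (s := Metric.ball (0 : ℂ) |(1 : ℝ)|)).circleAverage
    rw [Real.circleAverage, intervalIntegral.integral_of_le Real.two_pi_pos.le] at h
    rw [zero_smul] at h
    rw [← h, smul_smul, mul_inv_cancel₀ Real.two_pi_pos.ne', one_smul]
  have hswap := integral_integral_swap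
    (f := fun (θ : ℝ) (z : Fin n → ℂ) => f (circleMap 0 1 θ • z)) hint
  have hl : ∀ θ : ℝ, ∫ z, f (circleMap 0 1 θ • z) ∂fockGaussian n = ∫ z, f z ∂fockGaussian n :=
    fun θ => (hmp θ).integral_comp (hemb θ) f
  simp only [hl, havg, integral_const, probReal_univ, one_smul] at hswap
  have hI : I.real Set.univ = 2 * Real.pi := by
    simp [I, measureReal_def, Real.pi_pos.le]
  rw [hI] at hswap
  exact smul_right_injective _ Real.two_pi_pos.ne' hswap

end Gaussian

/-! ### The reproducing kernel -/

section Kernel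

variable {n : ℕ}

/-- The reproducing kernel `z ↦ e^{z·w̄}` of the Fock space. -/
def fockKernel (w z : Fin n → ℂ) : ℂ := Complex.exp (∑ j, z j * starRingEnd ℂ (w j))

theorem differentiable_fockKernel (w : Fin n → ℂ) : Differentiable ℂ (fockKernel w) := by
  unfold fockKernel; fun_prop

theorem fockKernel_conj (w z : Fin n → ℂ) :
    starRingEnd ℂ (fockKernel w z) = Complex.exp (∑ j, w j * starRingEnd ℂ (z j)) := by
  rw [fockKernel, ← Complex.exp_conj, map_sum]
  simp [mul_comm]

theorem norm_fockKernel_sq_mul (w z : Fin n → ℂ) :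
    ‖fockKernel w z‖ ^ 2 * Real.exp (-sqNorm z) =
      Real.exp (sqNorm w) * Real.exp (-sqNorm (z - w)) := by
  rw [fockKernel, Complex.norm_exp, ← Real.exp_nat_mul, ← Real.exp_add, ← Real.exp_add]
  congr 1
  simp only [sqNorm, Complex.re_sum, Nat.cast_ofNat, Finset.mul_sum, ← Finset.sum_neg_distrib,
    ← Finset.sum_add_distrib]
  refine Finset.sum_congr rfl fun j _ => ?_
  simp only [← Complex.normSq_eq_norm_sq, Complex.normSq_apply, Pi.sub_apply, Complex.sub_re,
    Complex.sub_im, Complex.mul_re, Complex.conj_re, Complex.conj_im]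
  ring

theorem memLp_fockKernel (w : Fin n → ℂ) : MemLp (fockKernel w) 2 (fockGaussian n) := by
  have hc := (differentiable_fockKernel w).continuous
  rw [memLp_two_iff_integrable_sq_norm hc.aestronglyMeasurable]
  refine Integrable.re (𝕜 := ℂ) (f := fun z => ((‖fockKernel w z‖ ^ 2 : ℝ) : ℂ)) ?_
  refine integrable_fockGaussian_iff.2 ?_
  refine ((integrable_exp_neg_sqNorm.comp_sub_right w).const_mul
    (Real.exp (sqNorm w))).ofReal (𝕜 := ℂ) |>.congr (Filter.Eventually.of_forall fun z => ?_)
  simp only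
  rw [← norm_fockKernel_sq_mul]
  exact Complex.ofReal_mul _ _

/-- The reproducing kernel as an element of `L₂(ℂⁿ, dg_n)`. -/
def fockKernelLp (w : Fin n → ℂ) : L2Gaussian n := (memLp_fockKernel w).toLp

theorem coeFn_fockKernelLp (w : Fin n → ℂ) :
    fockKernelLp w =ᵐ[fockGaussian n] fockKernel w := (memLp_fockKernel w).coeFn_toLp

theorem fockKernelLp_mem (w : Fin n → ℂ) : fockKernelLp w ∈ Fock n :=
  ⟨_, differentiable_fockKernel w, coeFn_fockKernelLp w⟩

theorem differentiable_fockEntire (f : Fock n) : Differentiable ℂ (fockEntire f) :=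
  (Classical.choose_spec f.2).1

theorem coeFn_fock (f : Fock n) : (f : L2Gaussian n) =ᵐ[fockGaussian n] fockEntire f :=
  (Classical.choose_spec f.2).2

/-- Removes the arbitrary choice in `fockEntire`: any continuous representative is the chosen one,
since the Gaussian measure charges every nonempty open set. -/
theorem fockEntire_eq {f : Fock n} {h : (Fin n → ℂ) → ℂ} (hh : Continuous h)
    (hf : (f : L2Gaussian n) =ᵐ[fockGaussian n] h) : fockEntire f = h :=
  eq_of_ae_eq_fockGaussian (differentiable_fockEntire f).continuous hh ((coeFn_fock f).symm.trans hf)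

/-- Translating by `w` and cancelling exponentials turns the integrand into `f(z+w) e^{-z·w̄}`
against the Gaussian. This is entire in `z` with value `f w` at `0`, so the mean value property
applies. -/
theorem integral_mul_conj_fockKernel {f : (Fin n → ℂ) → ℂ} (hf : Differentiable ℂ f)
    (hi : MemLp f 2 (fockGaussian n)) (w : Fin n → ℂ) :
    ∫ z, f z * starRingEnd ℂ (fockKernel w z) ∂fockGaussian n = f w := by
  have hint : Integrable (fun z => f z * starRingEnd ℂ (fockKernel w z)) (fockGaussian n) :=
    hi.integrable_mul (memLp_fockKernel w).star
  have hshift : ∀ z : Fin n → ℂ, f (z + w) * starRingEnd ℂ (fockKernel w (z + w)) *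
      (Real.exp (-sqNorm (z + w)) : ℂ) =
      (f (z + w) * fockKernel (-w) z) * (Real.exp (-sqNorm z) : ℂ) := by
    intro z
    rw [fockKernel_conj, mul_assoc, mul_assoc, fockKernel, Complex.ofReal_exp, Complex.ofReal_exp,
      ← Complex.exp_add, ← Complex.exp_add]
    congr 2
    push_cast [ofReal_sqNorm]
    simp only [← Finset.sum_neg_distrib, ← Finset.sum_add_distrib]
    refine Finset.sum_congr rfl fun j _ => ?_
    simp only [Pi.add_apply, Pi.neg_apply, map_add, map_neg]
    ring
  have hd : Differentiable ℂ fun z => f (z + w) * fockKernel (-w) z :=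
    (hf.comp (differentiable_id.add_const w)).mul (differentiable_fockKernel _)
  have hint' : Integrable (fun z => f (z + w) * fockKernel (-w) z) (fockGaussian n) := by
    refine integrable_fockGaussian_iff.2 ?_
    refine ((integrable_fockGaussian_iff.1 hint).comp_add_right w).congr
      (Filter.Eventually.of_forall hshift)
  have h := integral_fockGaussian_of_differentiable hd hint'
  rw [integral_fockGaussian] at h ⊢
  rw [← integral_add_right_eq_self _ w]
  simp only [hshift, h]
  simp [fockKernel]

/-- The reproducing property of the Fock space. -/
theorem inner_fockKernelLp (f : Fock n) (w : Fin n → ℂ) :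
    inner ℂ (fockKernelLp w) (f : L2Gaussian n) = fockEntire f w := by
  rw [L2.inner_def]
  have hm : MemLp (fockEntire f) 2 (fockGaussian n) :=
    (memLp_congr_ae (coeFn_fock f)).1 (Lp.memLp _)
  rw [← integral_mul_conj_fockKernel (differentiable_fockEntire f) hm w]
  refine integral_congr_ae ?_
  filter_upwards [coeFn_fockKernelLp w, coeFn_fock f] with z h1 h2
  rw [h1, h2, RCLike.inner_apply]

theorem fockEntire_fockKernelLp (w : Fin n → ℂ) :
    fockEntire ⟨fockKernelLp w, fockKernelLp_mem w⟩ = fockKernel w :=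
  fockEntire_eq (differentiable_fockKernel w).continuous (coeFn_fockKernelLp w)

theorem inner_fockKernelLp_fockKernelLp (w v : Fin n → ℂ) :
    inner ℂ (fockKernelLp w) (fockKernelLp v) = fockKernel v w := by
  rw [← fockEntire_fockKernelLp v]
  exact inner_fockKernelLp ⟨fockKernelLp v, fockKernelLp_mem v⟩ w

end Kernel

/-! ### Uniqueness for the Fourier transform of an integrable function -/

section FourierUniqueness

variable {E : Type*} [NormedAddCommGroup E] [NormedSpace ℝ E] [MeasurableSpace E] [BorelSpace E]
  [SecondCountableTopology E] [CompleteSpace E] {m : Measure E}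

/-- The positive and negative parts of `u` are densities of two finite measures with the same
characteristic function, hence of the same measure. -/
theorem ae_eq_zero_of_integral_mul_exp_eq_zero_of_real {u : E → ℝ} (hu : Integrable u m)
    (h : ∀ L : StrongDual ℝ E, ∫ x, (u x : ℂ) * Complex.exp (L x * Complex.I) ∂m = 0) :
    u =ᵐ[m] 0 := by
  have hm : AEMeasurable u m := hu.aestronglyMeasurable.aemeasurable
  have hp : AEMeasurable (fun x => ENNReal.ofReal (u x)) m := hm.ennreal_ofReal
  have hq : AEMeasurable (fun x => ENNReal.ofReal (-u x)) m := hm.neg.ennreal_ofReal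
  have hpf : ∫⁻ x, ENNReal.ofReal (u x) ∂m ≠ ∞ := hu.lintegral_lt_top.ne
  have hqf : ∫⁻ x, ENNReal.ofReal (-u x) ∂m ≠ ∞ := hu.neg.lintegral_lt_top.ne
  have := isFiniteMeasure_withDensity hpf
  have := isFiniteMeasure_withDensity hqf
  have key : m.withDensity (fun x => ENNReal.ofReal (u x)) =
      m.withDensity (fun x => ENNReal.ofReal (-u x)) := by
    refine Measure.ext_of_charFunDual (funext fun L => ?_)
    have hexp : ∀ x : E, ‖Complex.exp (L x * Complex.I)‖ ≤ 1 := fun x =>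
      (Complex.norm_exp_ofReal_mul_I _).le
    have hcexp : Continuous fun x : E => Complex.exp (L x * Complex.I) := by fun_prop
    have hi : ∀ v : E → ℝ, Integrable v m →
        Integrable (fun x => ((max (v x) 0 : ℝ) : ℂ) * Complex.exp (L x * Complex.I)) m :=
      fun v hv => (hv.pos_part.ofReal (𝕜 := ℂ)).mul_bdd (c := 1) hcexp.aestronglyMeasurable
        (Filter.Eventually.of_forall hexp)
    rw [charFunDual_apply, charFunDual_apply,
      integral_withDensity_eq_integral_toReal_smul₀ hp
        (Filter.Eventually.of_forall fun _ => ENNReal.ofReal_lt_top),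
      integral_withDensity_eq_integral_toReal_smul₀ hq
        (Filter.Eventually.of_forall fun _ => ENNReal.ofReal_lt_top)]
    simp only [ENNReal.toReal_ofReal', Complex.real_smul]
    rw [← sub_eq_zero, ← integral_sub (hi u hu) (hi (fun x => -u x) hu.neg), ← h L]
    refine integral_congr_ae (Filter.Eventually.of_forall fun x => ?_)
    simp only
    rw [← sub_mul, ← Complex.ofReal_sub]
    congr 2
    rcases le_total 0 (u x) with h0 | h0
    · rw [max_eq_left h0, max_eq_right (neg_nonpos.2 h0), sub_zero]
    · rw [max_eq_right h0, max_eq_left (neg_nonneg.2 h0)]; ring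
  filter_upwards [(withDensity_eq_iff hp hq hpf).1 key] with x hx
  rcases le_total 0 (u x) with h0 | h0
  · rw [ENNReal.ofReal_of_nonpos (neg_nonpos.2 h0), ENNReal.ofReal_eq_zero] at hx
    exact le_antisymm hx h0
  · rw [ENNReal.ofReal_of_nonpos h0, eq_comm, ENNReal.ofReal_eq_zero] at hx
    exact le_antisymm h0 (neg_nonpos.1 hx)

/-- An integrable function whose Fourier transform vanishes is zero. -/
theorem ae_eq_zero_of_integral_mul_exp_eq_zero {h : E → ℂ} (hh : Integrable h m)
    (hz : ∀ L : StrongDual ℝ E, ∫ x, h x * Complex.exp (L x * Complex.I) ∂m = 0) :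
    h =ᵐ[m] 0 := by
  have hre : ∀ f : E → ℂ, Integrable f m →
      (∀ L : StrongDual ℝ E, ∫ x, f x * Complex.exp (L x * Complex.I) ∂m = 0) →
      (fun x => (f x).re) =ᵐ[m] 0 := by
    intro f hf hL
    refine ae_eq_zero_of_integral_mul_exp_eq_zero_of_real hf.re fun L => ?_
    have hexp : ∀ M : StrongDual ℝ E, ∀ x : E, ‖Complex.exp (M x * Complex.I)‖ ≤ 1 := fun M x =>
      (Complex.norm_exp_ofReal_mul_I _).le
    have hcexp : ∀ M : StrongDual ℝ E, Continuous fun x : E => Complex.exp (M x * Complex.I) :=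
      fun M => by fun_prop
    have hi : ∀ M : StrongDual ℝ E, Integrable (fun x => f x * Complex.exp (M x * Complex.I)) m :=
      fun M => hf.mul_bdd (c := 1) (hcexp M).aestronglyMeasurable
        (Filter.Eventually.of_forall (hexp M))
    -- Conjugating the hypothesis at `-L` and adding it to the one at `L` isolates the transform of
    -- `2 Re f`.
    have hconj : ∫ x, starRingEnd ℂ (f x * Complex.exp ((-L) x * Complex.I)) ∂m = 0 := by
      rw [integral_conj, hL, map_zero]
    have hic : Integrable (fun x => starRingEnd ℂ (f x * Complex.exp ((-L) x * Complex.I))) m :=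
      (Complex.conjLIE.toContinuousLinearEquiv.integrable_comp_iff).2 (hi (-L))
    have hsum : ∫ x, (f x * Complex.exp (L x * Complex.I) +
        starRingEnd ℂ (f x * Complex.exp ((-L) x * Complex.I))) ∂m = 0 := by
      rw [integral_add (hi L) hic, hL, hconj, add_zero]
    have h2 : ∫ x, 2 * (((f x).re : ℂ) * Complex.exp (L x * Complex.I)) ∂m = 0 := by
      rw [← hsum]
      refine integral_congr_ae (Filter.Eventually.of_forall fun x => ?_)
      simp only
      have e1 : starRingEnd ℂ (Complex.exp ((-L) x * Complex.I)) =
          Complex.exp (L x * Complex.I) := by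
        rw [← Complex.exp_conj]
        simp
      rw [map_mul, e1, ← add_mul, Complex.add_conj]
      push_cast
      ring
    rw [integral_const_mul] at h2
    exact (mul_eq_zero.1 h2).resolve_left two_ne_zero
  have h1 := hre h hh hz
  -- The real part of `-i h` is the imaginary part of `h`.
  have h2 := hre (fun x => -Complex.I * h x) (hh.const_mul _) fun L => by
    simp only [mul_assoc]
    rw [integral_const_mul, hz L, mul_zero]
  filter_upwards [h1, h2] with x hx1 hx2
  refine Complex.ext hx1 ?_
  simpa using hx2

end FourierUniqueness

/-! ### Isometries from equal Gram matrices -/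

section GramExtension

variable {ι H K : Type*} [NormedAddCommGroup H] [InnerProductSpace ℂ H]
  [NormedAddCommGroup K] [InnerProductSpace ℂ K] [CompleteSpace K]

/-- Families with the same Gram matrix are related by an isometry, if the first one is total. -/
theorem exists_linearIsometry_of_inner_eq {φ : ι → H} {k : ι → K}
    (hG : ∀ i j, inner ℂ (k i) (k j) = inner ℂ (φ i) (φ j))
    (hd : Dense (Submodule.span ℂ (Set.range φ) : Set H)) :
    ∃ V : H →ₗᵢ[ℂ] K, ∀ i, V (φ i) = k i := by
  set e := Finsupp.linearCombination ℂ φ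
  set f := Finsupp.linearCombination ℂ k
  -- The norm of a linear combination depends only on the Gram matrix, so `f` factors through `e`
  -- isometrically.
  have hnorm : ∀ c, ‖f c‖ = ‖e c‖ := by
    intro c
    rw [@norm_eq_sqrt_re_inner ℂ, @norm_eq_sqrt_re_inner ℂ]
    simp only [e, f, Finsupp.linearCombination_apply, Finsupp.sum_inner, Finsupp.inner_sum,
      inner_smul_left, inner_smul_right, hG]
  have hde : DenseRange e := by
    have : Set.range e = (Submodule.span ℂ (Set.range φ) : Set H) := by
      rw [← Finsupp.range_linearCombination]; rfl
    rw [DenseRange, this]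
    exact hd
  have hb : ∃ C, ∀ c, ‖f c‖ ≤ C * ‖e c‖ := ⟨1, fun c => by rw [hnorm, one_mul]⟩
  have hV : ∀ c, f.extendOfNorm e (e c) = f c := fun c => LinearMap.extendOfNorm_eq hde hb c
  refine ⟨⟨(f.extendOfNorm e).toLinearMap, fun x => ?_⟩, fun i => ?_⟩
  · refine hde.induction_on x (isClosed_eq (by fun_prop) (by fun_prop)) fun c => ?_
    change ‖f.extendOfNorm e (e c)‖ = ‖e c‖
    rw [hV, hnorm]
  · have h := hV (Finsupp.single i 1)
    simpa [e, f] using h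

end GramExtension

/-! ### The Bargmann kernel and coherent states -/

section BargmannKernel

variable {n : ℕ}

theorem integrable_exp_quadratic {b : ℝ} (hb : 0 < b) (c : Fin n → ℝ) :
    Integrable fun x : Fin n → ℝ => Real.exp (-b * ∑ j, x j ^ 2 + ∑ j, c j * x j) := by
  have h := (GaussianFourier.integrable_cexp_neg_mul_sum_add (ι := Fin n) (b := (b : ℂ))
    (by simpa using hb) fun j => (c j : ℂ)).norm
  refine h.congr (Filter.Eventually.of_forall fun x => ?_)
  simp only [Complex.norm_exp]
  congr 1
  norm_cast

theorem memLp_exp_quadratic {b : ℝ} (hb : 0 < b) (c : Fin n → ℝ) :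
    MemLp (fun x : Fin n → ℝ => Real.exp (-b * ∑ j, x j ^ 2 + ∑ j, c j * x j)) 2 := by
  refine (memLp_two_iff_integrable_sq ?_).2 ?_
  · exact Continuous.aestronglyMeasurable (by fun_prop)
  · refine (integrable_exp_quadratic (n := n) (b := 2 * b) (by positivity)
      fun j => 2 * c j).congr (Filter.Eventually.of_forall fun x => ?_)
    simp only
    rw [← Real.exp_nat_mul]
    congr 1
    simp only [Nat.cast_ofNat, mul_add, Finset.mul_sum]
    congr 1 <;> exact Finset.sum_congr rfl fun j _ => by ring

/-- The kernel of the Bargmann transform. -/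
def bargmannKernel (z : Fin n → ℂ) (x : Fin n → ℝ) : ℂ :=
  ((Real.pi ^ (-(n : ℝ) / 4) : ℝ) : ℂ) *
    Complex.exp ((Real.sqrt 2 : ℂ) * (∑ j, (x j : ℂ) * z j)
      - (∑ j, (x j : ℂ) ^ 2) / 2 - (∑ j, z j ^ 2) / 2)

theorem bargmannIntegral_eq (g : (Fin n → ℝ) → ℂ) (z : Fin n → ℂ) :
    bargmannIntegral g z = ∫ x, g x * bargmannKernel z x := by
  rw [bargmannIntegral, ← integral_const_mul]
  refine integral_congr_ae (Filter.Eventually.of_forall fun x => ?_)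
  simp only [bargmannKernel]
  ring

theorem continuous_bargmannKernel :
    Continuous fun p : (Fin n → ℂ) × (Fin n → ℝ) => bargmannKernel p.1 p.2 := by
  unfold bargmannKernel; fun_prop

theorem norm_bargmannKernel (z : Fin n → ℂ) (x : Fin n → ℝ) :
    ‖bargmannKernel z x‖ = Real.pi ^ (-(n : ℝ) / 4) *
      Real.exp (∑ j, (Real.sqrt 2 * x j * (z j).re - x j ^ 2 / 2
        - ((z j).re ^ 2 - (z j).im ^ 2) / 2)) := by
  rw [bargmannKernel, norm_mul, Complex.norm_real, Real.norm_of_nonneg (by positivity),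
    Complex.norm_exp]
  congr 2
  simp only [Finset.sum_sub_distrib, Complex.sub_re, Complex.div_ofNat_re, Complex.re_sum,
    Complex.re_ofReal_mul, Finset.mul_sum, Finset.sum_div]
  congr 1
  · congr 1
    · exact Finset.sum_congr rfl fun j _ => by ring
    · exact Finset.sum_congr rfl fun j _ => by norm_cast
  · exact Finset.sum_congr rfl fun j _ => by
      congr 1
      rw [sq, Complex.mul_re]; ring

theorem memLp_bargmannKernel (z : Fin n → ℂ) : MemLp (bargmannKernel z) 2 := by
  refine (((memLp_exp_quadratic (n := n) (b := 1 / 2) (by norm_num)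
    fun j => Real.sqrt 2 * (z j).re)).const_mul (Real.pi ^ (-(n : ℝ) / 4) *
      Real.exp (∑ j, -((z j).re ^ 2 - (z j).im ^ 2) / 2))).mono ?_ ?_
  · exact (continuous_bargmannKernel.comp (Continuous.prodMk_right z)).aestronglyMeasurable
  · refine Filter.Eventually.of_forall fun x => le_of_eq ?_
    rw [norm_bargmannKernel, Real.norm_of_nonneg (by positivity), mul_assoc, ← Real.exp_add]
    congr 2
    simp only [Finset.mul_sum, ← Finset.sum_add_distrib]
    exact Finset.sum_congr rfl fun j _ => by ring

theorem integrable_mul_bargmannKernel {g : (Fin n → ℝ) → ℂ} (hg : MemLp g 2) (z : Fin n → ℂ) :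
    Integrable fun x => g x * bargmannKernel z x := hg.integrable_mul (memLp_bargmannKernel z)

theorem bargmannKernel_conj (z : Fin n → ℂ) (x : Fin n → ℝ) :
    starRingEnd ℂ (bargmannKernel z x) = bargmannKernel (fun j => starRingEnd ℂ (z j)) x := by
  rw [bargmannKernel, bargmannKernel, map_mul, ← Complex.exp_conj]
  simp [map_ofNat]

theorem ofReal_rpow_quarter_mul_self :
    ((Real.pi ^ (-(n : ℝ) / 4) : ℝ) : ℂ) * ((Real.pi ^ (-(n : ℝ) / 4) : ℝ) : ℂ) *
      ((Real.pi : ℂ) ^ ((n : ℂ) / 2)) = 1 := by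
  have h : ((Real.pi : ℂ) ^ ((n : ℂ) / 2)) = ((Real.pi ^ ((n : ℝ) / 2) : ℝ) : ℂ) := by
    rw [Complex.ofReal_cpow Real.pi_pos.le]
    push_cast
    rfl
  rw [h, ← Complex.ofReal_mul, ← Complex.ofReal_mul, ← Real.rpow_add Real.pi_pos,
    ← Real.rpow_add Real.pi_pos]
  have : -(n : ℝ) / 4 + -(n : ℝ) / 4 + (n : ℝ) / 2 = 0 := by ring
  rw [this, Real.rpow_zero, Complex.ofReal_one]

/-- A Gaussian integral; it identifies the Gram matrix of the coherent states with that of the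
reproducing kernels. -/
theorem integral_bargmannKernel_mul_conj (v w : Fin n → ℂ) :
    ∫ x, starRingEnd ℂ (bargmannKernel v x) * bargmannKernel w x = fockKernel v w := by
  set c : ℂ := ((Real.pi ^ (-(n : ℝ) / 4) : ℝ) : ℂ) with hc
  set d : ℂ := Complex.exp (-(∑ j, (starRingEnd ℂ (v j) ^ 2 + w j ^ 2)) / 2)
  have h : ∀ x : Fin n → ℝ, starRingEnd ℂ (bargmannKernel v x) * bargmannKernel w x =
      (c * c * d) * Complex.exp (-1 * ∑ j, (x j : ℂ) ^ 2 +
        ∑ j, ((Real.sqrt 2 : ℂ) * (starRingEnd ℂ (v j) + w j)) * x j) := by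
    intro x
    rw [bargmannKernel_conj, bargmannKernel, bargmannKernel, ← hc,
      mul_mul_mul_comm, ← Complex.exp_add, mul_assoc (c * c) d, ← Complex.exp_add]
    congr 2
    simp only [Finset.mul_sum, Finset.sum_div, ← Finset.sum_add_distrib, ← Finset.sum_sub_distrib,
      ← Finset.sum_neg_distrib]
    exact Finset.sum_congr rfl fun j _ => by ring
  simp only [h]
  rw [integral_const_mul, GaussianFourier.integral_cexp_neg_mul_sum_add (by simp), Fintype.card_fin,
    div_one]
  have h2 : ((Real.sqrt 2 : ℝ) : ℂ) ^ 2 = 2 := by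
    rw [← Complex.ofReal_pow, Real.sq_sqrt (by norm_num)]; norm_num
  calc c * c * d * ((Real.pi : ℂ) ^ ((n : ℂ) / 2) * _) = (c * c * (Real.pi : ℂ) ^ ((n : ℂ) / 2)) *
        (d * Complex.exp ((∑ j, ((Real.sqrt 2 : ℂ) * (starRingEnd ℂ (v j) + w j)) ^ 2)
          / (4 * 1))) := by ring
    _ = fockKernel v w := by
      rw [hc, ofReal_rpow_quarter_mul_self, one_mul, ← Complex.exp_add, fockKernel]
      congr 1
      simp only [mul_pow, h2, Finset.sum_div, ← Finset.sum_add_distrib, ← Finset.sum_neg_distrib]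
      exact Finset.sum_congr rfl fun j _ => by ring

/-- The conjugate of the Bargmann kernel, as an element of `L₂(ℝⁿ)`. -/
def coherentState (z : Fin n → ℂ) : L2Real n := (memLp_bargmannKernel z).star.toLp

theorem coeFn_coherentState (z : Fin n → ℂ) :
    coherentState z =ᵐ[volume] fun x => starRingEnd ℂ (bargmannKernel z x) :=
  (memLp_bargmannKernel z).star.coeFn_toLp

theorem inner_coherentState (z : Fin n → ℂ) (g : L2Real n) :
    inner ℂ (coherentState z) g = bargmannIntegral g z := by
  rw [L2.inner_def, bargmannIntegral_eq]
  refine integral_congr_ae ?_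
  filter_upwards [coeFn_coherentState z] with x hx
  rw [hx, RCLike.inner_apply, Complex.conj_conj]

theorem bargmannIntegral_coherentState (v w : Fin n → ℂ) :
    bargmannIntegral (coherentState v) w = fockKernel v w := by
  rw [bargmannIntegral_eq, ← integral_bargmannKernel_mul_conj]
  refine integral_congr_ae ?_
  filter_upwards [coeFn_coherentState v] with x hx
  rw [hx]

/-- At purely imaginary points the transform is, up to a nonzero factor, the Fourier transform of
`g` times the nowhere vanishing Gaussian `bargmannKernel 0`. -/
theorem eq_zero_of_bargmannIntegral_eq_zero {g : L2Real n}
    (h : ∀ z, bargmannIntegral g z = 0) : g = 0 := by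
  have hmem := Lp.memLp g
  have hz : (fun x => g x * bargmannKernel 0 x) =ᵐ[volume] 0 := by
    refine ae_eq_zero_of_integral_mul_exp_eq_zero (integrable_mul_bargmannKernel hmem 0)
      fun L => ?_
    -- Chosen so that `√2 x·ξ = i L(x)`.
    set ξ : Fin n → ℂ := fun j => (L (Pi.single j 1) / Real.sqrt 2 : ℝ) * Complex.I with hξ
    have hs2 : Real.sqrt 2 ≠ 0 := by positivity
    have hL : ∀ x : Fin n → ℝ, ((L x : ℝ) : ℂ) * Complex.I =
        (Real.sqrt 2 : ℂ) * ∑ j, (x j : ℂ) * ξ j := by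
      intro x
      have : L x = ∑ j, x j * L (Pi.single j 1) := by
        conv_lhs => rw [pi_eq_sum_univ' x, map_sum]
        exact Finset.sum_congr rfl fun j _ => by
          rw [map_smul, smul_eq_mul]
      rw [this]
      push_cast [hξ]
      rw [Finset.sum_mul, Finset.mul_sum]
      refine Finset.sum_congr rfl fun j _ => ?_
      have : (Real.sqrt 2 : ℂ) ≠ 0 := by exact_mod_cast hs2
      field_simp
    have hk : ∀ x : Fin n → ℝ, g x * bargmannKernel 0 x * Complex.exp (L x * Complex.I) =
        Complex.exp ((∑ j, ξ j ^ 2) / 2) * (g x * bargmannKernel ξ x) := by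
      intro x
      rw [hL, bargmannKernel, bargmannKernel]
      have : Complex.exp ((Real.sqrt 2 : ℂ) * (∑ j, (x j : ℂ) * ξ j)
          - (∑ j, (x j : ℂ) ^ 2) / 2 - (∑ j, ξ j ^ 2) / 2) * Complex.exp ((∑ j, ξ j ^ 2) / 2) =
          Complex.exp (- ((∑ j, (x j : ℂ) ^ 2) / 2)) *
            Complex.exp ((Real.sqrt 2 : ℂ) * (∑ j, (x j : ℂ) * ξ j)) := by
        rw [← Complex.exp_add, ← Complex.exp_add]
        congr 1
        ring
      simp only [Pi.zero_apply, mul_zero, Finset.sum_const_zero, zero_sub, ne_eq,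
        OfNat.ofNat_ne_zero, not_false_eq_true, zero_pow, zero_div, sub_zero]
      linear_combination (-(g x * ((Real.pi ^ (-(n : ℝ) / 4) : ℝ) : ℂ))) * this
    simp only [hk]
    rw [integral_const_mul, ← bargmannIntegral_eq, h, mul_zero]
  refine (Lp.eq_zero_iff_ae_eq_zero).2 ?_
  filter_upwards [hz] with x hx
  refine (mul_eq_zero.1 hx).resolve_right ?_
  exact mul_ne_zero (Complex.ofReal_ne_zero.2 (Real.rpow_pos_of_pos Real.pi_pos _).ne')
    (Complex.exp_ne_zero _)

theorem dense_span_coherentState :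
    Dense (Submodule.span ℂ (Set.range (coherentState (n := n))) : Set (L2Real n)) := by
  rw [Submodule.dense_iff_topologicalClosure_eq_top, Submodule.topologicalClosure_eq_top_iff,
    Submodule.eq_bot_iff]
  intro g hg
  refine eq_zero_of_bargmannIntegral_eq_zero fun z => ?_
  rw [← inner_coherentState]
  exact (Submodule.mem_orthogonal _ _).1 hg _ (Submodule.subset_span ⟨z, rfl⟩)

end BargmannKernel

/-! ### Unitarity of the Bargmann transform -/

section BargmannUnitary

variable {n : ℕ}

/-- The logarithmic derivative of the Bargmann kernel in `z`. -/
def bargmannLogDeriv (z : Fin n → ℂ) (x : Fin n → ℝ) : (Fin n → ℂ) →L[ℂ] ℂ :=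
  ∑ j, ((Real.sqrt 2 : ℂ) * x j - z j) • ContinuousLinearMap.proj j

theorem continuous_bargmannLogDeriv (z : Fin n → ℂ) : Continuous (bargmannLogDeriv z) := by
  unfold bargmannLogDeriv; fun_prop

theorem norm_bargmannLogDeriv_le (z : Fin n → ℂ) (x : Fin n → ℝ) :
    ‖bargmannLogDeriv z x‖ ≤ ∑ j, (Real.sqrt 2 * |x j| + ‖z j‖) := by
  refine (norm_sum_le _ _).trans (Finset.sum_le_sum fun j _ => ?_)
  have h1 : ‖(ContinuousLinearMap.proj j : (Fin n → ℂ) →L[ℂ] ℂ)‖ ≤ 1 :=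
    ContinuousLinearMap.opNorm_le_bound _ zero_le_one fun w => by
      rw [one_mul]; exact norm_le_pi_norm w j
  rw [norm_smul]
  refine (mul_le_of_le_one_right (norm_nonneg _) h1).trans ((norm_sub_le _ _).trans_eq ?_)
  rw [norm_mul, Complex.norm_real, Complex.norm_real, Real.norm_of_nonneg (Real.sqrt_nonneg _),
    Real.norm_eq_abs]

theorem hasFDerivAt_bargmannKernel (z : Fin n → ℂ) (x : Fin n → ℝ) :
    HasFDerivAt (fun w => bargmannKernel w x) (bargmannKernel z x • bargmannLogDeriv z x) z := by
  have hp : ∀ j, HasFDerivAt (fun w : Fin n → ℂ => w j)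
      (ContinuousLinearMap.proj j : (Fin n → ℂ) →L[ℂ] ℂ) z := fun j => hasFDerivAt_apply j z
  have h1 := (HasFDerivAt.fun_sum (u := Finset.univ) fun j _ =>
    (hp j).const_mul (x j : ℂ)).const_mul (Real.sqrt 2 : ℂ)
  have h2 := (HasFDerivAt.fun_sum (u := Finset.univ) fun j _ => (hp j).pow 2).mul_const (2⁻¹ : ℂ)
  have h3 := (((h1.sub_const ((∑ j, (x j : ℂ) ^ 2) / 2)).sub h2).cexp).const_mul
    ((Real.pi ^ (-(n : ℝ) / 4) : ℝ) : ℂ)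
  simp only [← div_eq_mul_inv] at h3
  refine HasFDerivAt.congr_fderiv (f := fun w => bargmannKernel w x) h3 ?_
  rw [smul_smul]
  change bargmannKernel z x • _ = _
  congr 1
  ext w
  simp only [bargmannLogDeriv, sum_apply, smul_apply,
    sub_apply, smul_eq_mul, ContinuousLinearMap.proj_apply, Finset.mul_sum,
    ← Finset.sum_sub_distrib]
  refine Finset.sum_congr rfl fun j _ => ?_
  simp only [nsmul_eq_mul]
  push_cast
  ring

/-- A bound of the Bargmann kernel and its logarithmic derivative, uniform for bounded `z`. -/
theorem norm_bargmannKernel_smul_bargmannLogDeriv_le {R : ℝ} {z : Fin n → ℂ} (hz : ‖z‖ ≤ R)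
    (x : Fin n → ℝ) :
    ‖bargmannKernel z x • bargmannLogDeriv z x‖ ≤ Real.pi ^ (-(n : ℝ) / 4) *
      Real.exp (∑ _j : Fin n, (2 * (R + 1) ^ 2 + R + R ^ 2 / 2)) *
        Real.exp (-(1 / 4) * ∑ j, x j ^ 2 + ∑ j, 0 * x j) := by
  have hzj : ∀ j, ‖z j‖ ≤ R := fun j => (norm_le_pi_norm z j).trans hz
  have h1 : ‖bargmannLogDeriv z x‖ ≤ Real.exp (∑ j, (Real.sqrt 2 * |x j| + R)) := by
    refine (norm_bargmannLogDeriv_le z x).trans ((Finset.sum_le_sum fun j _ =>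
      add_le_add_right (hzj j) _).trans ?_)
    linarith [Real.add_one_le_exp (∑ j, (Real.sqrt 2 * |x j| + R))]
  rw [norm_smul, norm_bargmannKernel, mul_assoc, mul_assoc]
  refine mul_le_mul_of_nonneg_left ?_ (by positivity)
  refine (mul_le_mul_of_nonneg_left h1 (Real.exp_nonneg _)).trans ?_
  rw [← Real.exp_add, ← Real.exp_add, Real.exp_le_exp]
  simp only [zero_mul, Finset.sum_const_zero, add_zero, Finset.mul_sum, ← Finset.sum_add_distrib]
  refine Finset.sum_le_sum fun j _ => ?_
  have hR : 0 ≤ R := (norm_nonneg z).trans hz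
  have hre : |(z j).re| ≤ R := (Complex.abs_re_le_norm _).trans (hzj j)
  have him : |(z j).im| ≤ R := (Complex.abs_im_le_norm _).trans (hzj j)
  have him2 : (z j).im ^ 2 ≤ R ^ 2 := sq_le_sq' (abs_le.1 him).1 (abs_le.1 him).2
  have hs : Real.sqrt 2 ^ 2 = 2 := Real.sq_sqrt (by norm_num)
  have hs0 := Real.sqrt_nonneg 2
  have hx : x j * (z j).re ≤ |x j| * R := (le_abs_self _).trans (by
    rw [abs_mul]; exact mul_le_mul_of_nonneg_left hre (abs_nonneg _))
  have hx2 : Real.sqrt 2 * (x j * (z j).re) ≤ Real.sqrt 2 * (|x j| * R) :=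
    mul_le_mul_of_nonneg_left hx hs0
  -- Half of the decay `x²/2` absorbs the linear growth `√2 |x| (R+1)`: `R` comes from the kernel,
  -- `1` from bounding the logarithmic derivative by an exponential. The other half is the `1/4` of
  -- the bound.
  have hsq := sq_nonneg (|x j| / 2 - Real.sqrt 2 * (R + 1))
  have hxx := sq_abs (x j)
  have hexp : (|x j| / 2 - Real.sqrt 2 * (R + 1)) ^ 2 =
      x j ^ 2 / 4 - Real.sqrt 2 * |x j| * (R + 1) + 2 * (R + 1) ^ 2 := by
    rw [sub_sq, mul_pow, hs, div_pow, hxx]; ring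
  nlinarith [sq_nonneg (z j).re]

theorem differentiable_bargmannIntegral {g : (Fin n → ℝ) → ℂ} (hg : MemLp g 2) :
    Differentiable ℂ (bargmannIntegral g) := by
  intro z₀
  have hfun : bargmannIntegral g = fun z => ∫ x, g x * bargmannKernel z x :=
    funext fun z => bargmannIntegral_eq g z
  rw [hfun]
  have hk : ∀ z : Fin n → ℂ, Continuous (bargmannKernel z) := fun z => by
    unfold bargmannKernel; fun_prop
  set C : ℝ := Real.pi ^ (-(n : ℝ) / 4) *
    Real.exp (∑ _j : Fin n, (2 * (‖z₀‖ + 1 + 1) ^ 2 + (‖z₀‖ + 1) + (‖z₀‖ + 1) ^ 2 / 2)) with hC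
  let F' : (Fin n → ℂ) → (Fin n → ℝ) → (Fin n → ℂ) →L[ℂ] ℂ :=
    fun z x => g x • (bargmannKernel z x • bargmannLogDeriv z x)
  let bound : (Fin n → ℝ) → ℝ := fun x =>
    ‖g x‖ * (C * Real.exp (-(1 / 4) * ∑ j, x j ^ 2 + ∑ j, 0 * x j))
  have hmeas : AEStronglyMeasurable (F' z₀) volume :=
    hg.aestronglyMeasurable.smul ((hk z₀).smul (continuous_bargmannLogDeriv z₀)).aestronglyMeasurable
  have hbound : ∀ x, ∀ z ∈ Metric.ball z₀ 1, ‖F' z x‖ ≤ bound x := by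
    intro x z hz
    have h1 := norm_le_norm_add_norm_sub' z z₀
    have h2 := mem_ball_iff_norm.1 hz
    have h3 : ‖z‖ ≤ ‖z₀‖ + 1 := by linarith
    change ‖g x • (bargmannKernel z x • bargmannLogDeriv z x)‖ ≤ _
    rw [norm_smul]
    exact mul_le_mul_of_nonneg_left (norm_bargmannKernel_smul_bargmannLogDeriv_le h3 x)
      (norm_nonneg _)
  have hint : Integrable bound volume :=
    hg.norm.integrable_mul
      ((memLp_exp_quadratic (n := n) (b := 1 / 4) (by norm_num) fun _ => 0).const_mul C)
  have hderiv : ∀ x, ∀ z ∈ Metric.ball z₀ 1,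
      HasFDerivAt (fun w => g x * bargmannKernel w x) (F' z x) z := fun x z _ =>
    (hasFDerivAt_bargmannKernel z x).const_mul (g x)
  exact (hasFDerivAt_integral_of_dominated_of_fderiv_le (𝕜 := ℂ) (μ := volume)
    (F := fun z x => g x * bargmannKernel z x) (F' := F') (bound := bound)
    (Metric.ball_mem_nhds z₀ one_pos)
    (Filter.Eventually.of_forall fun z => (integrable_mul_bargmannKernel hg z).aestronglyMeasurable)
    (integrable_mul_bargmannKernel hg z₀) hmeas (Filter.Eventually.of_forall hbound) hint
    (Filter.Eventually.of_forall hderiv)).differentiableAt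

theorem exists_bargmann_isometry :
    ∃ V : L2Real n →ₗᵢ[ℂ] L2Gaussian n, ∀ g, V g =ᵐ[fockGaussian n] bargmannIntegral g := by
  obtain ⟨V, hV⟩ := exists_linearIsometry_of_inner_eq (φ := coherentState (n := n))
    (k := fockKernelLp) (fun v w => by
      rw [inner_fockKernelLp_fockKernelLp, inner_coherentState, bargmannIntegral_coherentState])
    dense_span_coherentState
  refine ⟨V, fun g => ?_⟩
  have hadd : ∀ (a b : L2Real n) z,
      bargmannIntegral (a + b : L2Real n) z = bargmannIntegral a z + bargmannIntegral b z :=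
    fun a b z => by simp only [← inner_coherentState, inner_add_right]
  have hsmul : ∀ (c : ℂ) (a : L2Real n) z,
      bargmannIntegral (c • a : L2Real n) z = c * bargmannIntegral a z :=
    fun c a z => by simp only [← inner_coherentState, inner_smul_right]
  have hspan : ∀ a ∈ Submodule.span ℂ (Set.range (coherentState (n := n))),
      V a =ᵐ[fockGaussian n] bargmannIntegral a := by
    intro a ha
    induction ha using Submodule.span_induction with
    | mem a ha =>
      obtain ⟨w, rfl⟩ := ha
      rw [hV]
      filter_upwards [coeFn_fockKernelLp w] with z hz
      rw [hz, bargmannIntegral_coherentState]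
    | zero =>
      rw [map_zero]
      filter_upwards [Lp.coeFn_zero ℂ 2 (fockGaussian n)] with z hz
      rw [hz, ← inner_coherentState, inner_zero_right, Pi.zero_apply]
    | add a b _ _ ha hb =>
      rw [map_add]
      filter_upwards [ha, hb, Lp.coeFn_add (V a) (V b)] with z h1 h2 h3
      rw [h3, Pi.add_apply, h1, h2, hadd]
    | smul c a _ ha =>
      rw [map_smul]
      filter_upwards [ha, Lp.coeFn_smul c (V a)] with z h1 h2
      rw [h2, Pi.smul_apply, h1, hsmul, smul_eq_mul]
  -- Norm convergence of `V (a m)` yields a.e. convergence along a subsequence, while the Bargmann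
  -- integrals converge at every point, being inner products with a fixed coherent state.
  obtain ⟨a, ha, hag⟩ := mem_closure_iff_seq_limit.1 (dense_span_coherentState (n := n) g)
  have hlim : Filter.Tendsto (fun m => V (a m)) Filter.atTop (nhds (V g)) :=
    (V.continuous.tendsto g).comp hag
  obtain ⟨ns, hns, hae⟩ := (tendstoInMeasure_of_tendsto_Lp hlim).exists_seq_tendsto_ae
  have hall : ∀ᵐ z ∂fockGaussian n, ∀ m, V (a m) z = bargmannIntegral (a m) z :=
    ae_all_iff.2 fun m => hspan (a m) (ha m)
  filter_upwards [hae, hall] with z h1 h2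
  refine tendsto_nhds_unique h1 ?_
  simp only [h2, ← inner_coherentState]
  exact ((innerSL ℂ (coherentState z)).continuous.tendsto g).comp
    (hag.comp hns.tendsto_atTop)

/-- The Bargmann transform is a unitary operator from `L₂(ℝⁿ)` onto the Fock space. -/
theorem exists_isBargmann : ∃ U : L2Real n ≃ₗᵢ[ℂ] Fock n, IsBargmann U := by
  obtain ⟨V, hV⟩ := exists_bargmann_isometry (n := n)
  have hmem : ∀ g, V g ∈ Fock n := fun g =>
    ⟨_, differentiable_bargmannIntegral (Lp.memLp g), hV g⟩
  let W : L2Real n →ₗᵢ[ℂ] Fock n :=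
    ⟨V.toLinearMap.codRestrict (Fock n) hmem, fun g => V.norm_map g⟩
  have hW : ∀ g, fockEntire (W g) = bargmannIntegral g := fun g =>
    fockEntire_eq (differentiable_bargmannIntegral (Lp.memLp g)).continuous (hV g)
  have hsurj : Function.Surjective W := by
    intro f
    have hcomplete : IsComplete (LinearMap.range V.toLinearMap : Set (L2Gaussian n)) := by
      have : (LinearMap.range V.toLinearMap : Set (L2Gaussian n)) = Set.range V := rfl
      rw [this]
      exact V.isometry.isUniformInducing.isComplete_range
    have : CompleteSpace (LinearMap.range V.toLinearMap) := hcomplete.completeSpace_coe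
    have : (LinearMap.range V.toLinearMap).HasOrthogonalProjection :=
      Submodule.HasOrthogonalProjection.ofCompleteSpace _
    obtain ⟨p, ⟨g, hg⟩, q, hq, hpq⟩ :=
      (LinearMap.range V.toLinearMap).exists_add_mem_mem_orthogonal (f : L2Gaussian n)
    have hpF : p ∈ Fock n := hg ▸ hmem g
    have hqF : q ∈ Fock n := by
      have : q = f - p := by rw [hpq]; abel
      rw [this]
      exact (Fock n).sub_mem f.2 hpF
    have hker : ∀ w, V (coherentState w) = fockKernelLp w := by
      intro w
      refine Lp.ext ?_
      filter_upwards [hV (coherentState w), coeFn_fockKernelLp w] with z h1 h2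
      rw [h1, h2, bargmannIntegral_coherentState]
    -- The range contains every reproducing kernel, so a Fock element orthogonal to it vanishes
    -- pointwise.
    have hq0 : q = 0 := by
      have h0 : fockEntire (⟨q, hqF⟩ : Fock n) = 0 := by
        funext w
        rw [← inner_fockKernelLp, ← hker]
        exact (Submodule.mem_orthogonal _ _).1 hq _ ⟨coherentState w, rfl⟩
      refine (Lp.eq_zero_iff_ae_eq_zero).2 ?_
      have := coeFn_fock (⟨q, hqF⟩ : Fock n)
      rwa [h0] at this
    refine ⟨g, Subtype.ext ?_⟩
    rw [hpq, hq0, add_zero]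
    exact hg
  exact ⟨LinearIsometryEquiv.ofSurjective W hsurj, fun g z => congrFun (hW g) z⟩

end BargmannUnitary

/-! ### Bounded Gaussian averages -/

section GaussianBounded

variable {n : ℕ}

/-- The Gaussian averages of `σ` are uniformly bounded. -/
def HasBoundedGaussianAverages (σ : Measure (Fin n → ℝ)) : Prop :=
  ∃ C : ℝ≥0∞, C ≠ ∞ ∧
    ∀ a : Fin n → ℝ, ∫⁻ x, ENNReal.ofReal (Real.exp (-∑ j, (x j - a j) ^ 2)) ∂σ ≤ C

variable {σ : Measure (Fin n → ℝ)}

theorem continuous_spectralKernel :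
    Continuous fun p : (Fin n → ℝ) × (Fin n → ℝ) => spectralKernel p.1 p.2 := by
  unfold spectralKernel; fun_prop

theorem norm_spectralKernel (x y : Fin n → ℝ) :
    ‖spectralKernel x y‖ = Real.exp (-∑ j, (x j - Real.sqrt 2 * y j) ^ 2) := by
  rw [spectralKernel, Complex.norm_real, Real.norm_of_nonneg (Real.exp_nonneg _)]

/-- The exponent equals `-2(y - x/√2)²`; dropping the factor `2` leaves the Gaussian centred at
`x/√2`. -/
theorem norm_spectralKernel_le (x y : Fin n → ℝ) :
    ‖spectralKernel x y‖ ≤ Real.exp (-∑ j, (y j - x j / Real.sqrt 2) ^ 2) := by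
  rw [norm_spectralKernel, Real.exp_le_exp, neg_le_neg_iff]
  refine Finset.sum_le_sum fun j _ => ?_
  have hs : Real.sqrt 2 ^ 2 = 2 := Real.sq_sqrt (by norm_num)
  have h : x j - Real.sqrt 2 * y j = -(Real.sqrt 2 * (y j - x j / Real.sqrt 2)) := by
    field_simp
    ring
  rw [h, neg_sq, mul_pow, hs]
  linarith [sq_nonneg (y j - x j / Real.sqrt 2)]

theorem HasBoundedGaussianAverages.exists_lintegral_spectralKernel_le
    (hσ : HasBoundedGaussianAverages σ) :
    ∃ C : ℝ≥0∞, C ≠ ∞ ∧ ∀ x : Fin n → ℝ, ∫⁻ y, ‖spectralKernel x y‖ₑ ∂σ ≤ C := by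
  obtain ⟨C, hC, h⟩ := hσ
  refine ⟨C, hC, fun x => le_trans (lintegral_mono fun y => ?_) (h fun j => x j / Real.sqrt 2)⟩
  rw [← ofReal_norm]
  exact ENNReal.ofReal_le_ofReal (norm_spectralKernel_le x y)

theorem HasBoundedGaussianAverages.integrable_spectralKernel
    (hσ : HasBoundedGaussianAverages σ) (x : Fin n → ℝ) : Integrable (spectralKernel x) σ := by
  obtain ⟨C, hC, h⟩ := hσ.exists_lintegral_spectralKernel_le
  exact ⟨(continuous_spectralKernel.comp (Continuous.prodMk_right x)).aestronglyMeasurable,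
    (h x).trans_lt hC.lt_top⟩

theorem HasBoundedGaussianAverages.memLp_integral_spectralKernel [SFinite σ]
    (hσ : HasBoundedGaussianAverages σ) :
    MemLp (fun x => ∫ y, spectralKernel x y ∂σ) ∞ volume := by
  obtain ⟨C, hC, h⟩ := hσ.exists_lintegral_spectralKernel_le
  refine memLp_top_of_bound (C := C.toReal) ?_ (Filter.Eventually.of_forall fun x => ?_)
  · exact (StronglyMeasurable.integral_prod_right' (ν := σ)
      continuous_spectralKernel.stronglyMeasurable).aestronglyMeasurable
  · have := (enorm_integral_le_lintegral_enorm (μ := σ) (spectralKernel x)).trans (h x)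
    rw [← toReal_enorm]
    exact ENNReal.toReal_mono hC this

end GaussianBounded

/-! ### Consequences of the Carleson condition -/

section Carleson

variable {n : ℕ}

theorem norm_fockKernelLp_sq (w : Fin n → ℂ) : ‖fockKernelLp w‖ ^ 2 = Real.exp (sqNorm w) := by
  have h := inner_self_eq_norm_sq_to_K (𝕜 := ℂ) (fockKernelLp w)
  rw [inner_fockKernelLp_fockKernelLp, fockKernel, ← ofReal_sqNorm, ← Complex.ofReal_exp] at h
  exact Complex.ofReal_injective ((Complex.ofReal_pow _ _).trans h.symm)

theorem sqNorm_realProdEquivComplex_sub (x y a : Fin n → ℝ) :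
    sqNorm (realProdEquivComplex n (x, y) - fun j => (a j : ℂ)) =
      ∑ j, (x j - a j) ^ 2 + ∑ j, y j ^ 2 := by
  rw [sqNorm, ← Finset.sum_add_distrib]
  refine Finset.sum_congr rfl fun j _ => ?_
  rw [← Complex.normSq_eq_norm_sq, Complex.normSq_apply]
  simp [realProdEquivComplex]
  ring

/-- Test on the kernel at the real point `a`. Its squared norm `e^{|a|²}` cancels, and the Gaussian
splits into one in `x - a` and one in `y`, whose integral `Y` does not depend on `a`. -/
theorem IsFockCarleson.hasBoundedGaussianAverages {μ : LocalComplexMeasure (Fin n → ℂ)}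
    (hFC : IsFockCarleson μ) {σ : Measure (Fin n → ℝ)} [SFinite σ]
    (hσ : (σ.prod volume).map (realProdEquivComplex n) ≤ μ.variation) :
    HasBoundedGaussianAverages σ := by
  obtain ⟨C, hC, h⟩ := hFC
  set Y : ℝ≥0∞ := ∫⁻ y : Fin n → ℝ, ENNReal.ofReal (Real.exp (-∑ j, y j ^ 2)) with hY
  have hY0 : Y ≠ 0 := by
    rw [hY, Ne, lintegral_eq_zero_iff (by fun_prop)]
    intro h0
    have hpos : ∀ y : Fin n → ℝ, ENNReal.ofReal (Real.exp (-∑ j, y j ^ 2)) ≠ 0 := fun y => by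
      rw [Ne, ENNReal.ofReal_eq_zero, not_le]; positivity
    obtain ⟨y, hy⟩ := h0.exists
    exact hpos y hy
  refine ⟨ENNReal.ofReal C / Y, ENNReal.div_ne_top ENNReal.ofReal_ne_top hY0, fun a => ?_⟩
  set α : Fin n → ℂ := fun j => (a j : ℂ)
  have h1 := (lintegral_mono' hσ le_rfl).trans (h ⟨fockKernelLp α, fockKernelLp_mem α⟩)
  rw [fockEntire_fockKernelLp, lintegral_map_equiv, Submodule.coe_norm, norm_fockKernelLp_sq] at h1
  simp only [norm_fockKernel_sq_mul] at h1
  have h2 : ∀ p : (Fin n → ℝ) × (Fin n → ℝ),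
      ENNReal.ofReal (Real.exp (sqNorm α) *
        Real.exp (-sqNorm (realProdEquivComplex n p - α))) =
      ENNReal.ofReal (Real.exp (sqNorm α)) *
        (ENNReal.ofReal (Real.exp (-∑ j, (p.1 j - a j) ^ 2)) *
          ENNReal.ofReal (Real.exp (-∑ j, p.2 j ^ 2))) := by
    rintro ⟨x, y⟩
    rw [ENNReal.ofReal_mul (Real.exp_nonneg _), sqNorm_realProdEquivComplex_sub, neg_add,
      Real.exp_add, ENNReal.ofReal_mul (Real.exp_nonneg _)]
  simp only [h2] at h1
  have h3 := lintegral_prod_mul (μ := σ) (ν := (volume : Measure (Fin n → ℝ)))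
    (f := fun x => ENNReal.ofReal (Real.exp (-∑ j, (x j - a j) ^ 2)))
    (g := fun y => ENNReal.ofReal (Real.exp (-∑ j, y j ^ 2))) (Measurable.aemeasurable (by fun_prop))
    (Measurable.aemeasurable (by fun_prop))
  rw [lintegral_const_mul _ (by fun_prop), h3, mul_comm C, ENNReal.ofReal_mul (Real.exp_nonneg _)] at h1
  rw [ENNReal.le_div_iff_mul_le (Or.inl hY0) (Or.inr ENNReal.ofReal_ne_top)]
  exact (ENNReal.mul_le_mul_iff_right
    (by rw [Ne, ENNReal.ofReal_eq_zero, not_le]; positivity) ENNReal.ofReal_ne_top).1 h1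

theorem IsFockCarleson.integrable_norm_sq_mul {μ : LocalComplexMeasure (Fin n → ℂ)}
    (hFC : IsFockCarleson μ) (f : Fock n) :
    Integrable (fun w => ‖fockEntire f w‖ ^ 2 * Real.exp (-sqNorm w)) μ.variation := by
  obtain ⟨C, hC, h⟩ := hFC
  have hc := (differentiable_fockEntire f).continuous
  refine (lintegral_ofReal_ne_top_iff_integrable ?_ ?_).1
    ((h f).trans_lt ENNReal.ofReal_lt_top).ne
  · exact ((hc.norm.pow 2).mul
      (Real.continuous_exp.comp continuous_sqNorm.neg)).aestronglyMeasurable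
  · exact Filter.Eventually.of_forall fun w => by positivity

theorem toeplitzIntegrand_eq (f : (Fin n → ℂ) → ℂ) (z w : Fin n → ℂ) :
    toeplitzIntegrand f z w =
      starRingEnd ℂ (fockKernel z w) * f w * (Real.exp (-sqNorm w) : ℂ) := by
  rw [toeplitzIntegrand, fockKernel_conj]

/-- Since `ab ≤ a² + b²`, the Carleson condition for `f` and for the reproducing kernel at `z`
suffices. -/
theorem IsFockCarleson.integrable_toeplitzIntegrand {μ : LocalComplexMeasure (Fin n → ℂ)}
    (hFC : IsFockCarleson μ) (f : Fock n) (z : Fin n → ℂ) :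
    Integrable (toeplitzIntegrand (fockEntire f) z) μ.variation := by
  have h1 := hFC.integrable_norm_sq_mul f
  have h2 := hFC.integrable_norm_sq_mul ⟨fockKernelLp z, fockKernelLp_mem z⟩
  rw [fockEntire_fockKernelLp] at h2
  refine (h2.add h1).mono' ?_ (Filter.Eventually.of_forall fun w => ?_)
  · have hf := (differentiable_fockEntire f).continuous
    have hs := continuous_sqNorm (n := n)
    refine Continuous.aestronglyMeasurable ?_
    unfold toeplitzIntegrand
    fun_prop
  · rw [toeplitzIntegrand_eq, norm_mul, norm_mul, Complex.norm_real,
      Real.norm_of_nonneg (Real.exp_nonneg _), RCLike.norm_conj, Pi.add_apply, ← add_mul]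
    refine mul_le_mul_of_nonneg_right ?_ (Real.exp_nonneg _)
    nlinarith [sq_nonneg (‖fockKernel z w‖ - ‖fockEntire f w‖), sq_nonneg ‖fockKernel z w‖,
      sq_nonneg ‖fockEntire f w‖]

end Carleson

/-! ### The integrand of the triple integral -/

section TripleIntegral

variable {n : ℕ} {σ : Measure (Fin n → ℝ)}

/-- The factor of the Toeplitz integrand which carries the dependence on the imaginary part. -/
def shiftedGaussian (z : Fin n → ℂ) (t x y : Fin n → ℝ) : ℂ :=
  Complex.exp (∑ j, ((Real.sqrt 2 : ℂ) * t j - x j - z j + Complex.I * y j) ^ 2 / 2)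

theorem sqrt_two_sq : (Real.sqrt 2 : ℂ) ^ 2 = 2 := by
  rw [← Complex.ofReal_pow, Real.sq_sqrt (by norm_num)]; norm_num

theorem exp_mul_bargmannKernel_mul_exp (z : Fin n → ℂ) (t x y : Fin n → ℝ) :
    Complex.exp (∑ j, z j * starRingEnd ℂ (realProdEquivComplex n (x, y) j)) *
        bargmannKernel (realProdEquivComplex n (x, y)) t *
        (Real.exp (-sqNorm (realProdEquivComplex n (x, y))) : ℂ) =
      bargmannKernel z t * spectralKernel t x * shiftedGaussian z t x y := by
  set c : ℂ := ((Real.pi ^ (-(n : ℝ) / 4) : ℝ) : ℂ) with hc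
  rw [bargmannKernel, bargmannKernel, spectralKernel, shiftedGaussian, Complex.ofReal_exp,
    Complex.ofReal_exp, ← hc]
  rw [mul_left_comm, ← Complex.exp_add, mul_assoc, ← Complex.exp_add, mul_assoc c, mul_assoc c,
    ← Complex.exp_add, ← Complex.exp_add]
  congr 2
  push_cast [ofReal_sqNorm]
  simp only [Finset.mul_sum, Finset.sum_div, ← Finset.sum_add_distrib, ← Finset.sum_sub_distrib,
    ← Finset.sum_neg_distrib]
  refine Finset.sum_congr rfl fun j _ => ?_
  have hw : realProdEquivComplex n (x, y) j = (x j : ℂ) + Complex.I * y j := by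
    apply Complex.ext <;> simp [realProdEquivComplex]
  have hw' : starRingEnd ℂ (realProdEquivComplex n (x, y) j) = (x j : ℂ) - Complex.I * y j := by
    apply Complex.ext <;> simp [realProdEquivComplex]
  rw [hw', hw]
  have h2 := sqrt_two_sq
  linear_combination ((x j : ℂ) ^ 2 - (t j : ℂ) ^ 2 / 2) * h2

/-- With `u = √2t - x - z` the exponent is `(u + iy)²/2`; the complex shift `u` does not affect the
integral. -/
theorem integral_shiftedGaussian (z : Fin n → ℂ) (t x : Fin n → ℝ) :
    ∫ y, shiftedGaussian z t x y = (((2 * Real.pi) ^ ((n : ℝ) / 2) : ℝ) : ℂ) := by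
  set u : Fin n → ℂ := fun j => (Real.sqrt 2 : ℂ) * t j - x j - z j with hu
  have h : ∀ y : Fin n → ℝ, shiftedGaussian z t x y = Complex.exp ((∑ j, u j ^ 2) / 2) *
      Complex.exp (-(1 / 2 : ℂ) * ∑ j, (y j : ℂ) ^ 2 + ∑ j, (Complex.I * u j) * y j) := by
    intro y
    rw [shiftedGaussian, ← Complex.exp_add]
    congr 1
    simp only [Finset.mul_sum, Finset.sum_div, ← Finset.sum_add_distrib]
    refine Finset.sum_congr rfl fun j _ => ?_
    linear_combination ((y j : ℂ) ^ 2 / 2) * Complex.I_sq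
  simp only [h]
  rw [integral_const_mul, GaussianFourier.integral_cexp_neg_mul_sum_add (by norm_num),
    Fintype.card_fin, mul_left_comm, ← Complex.exp_add]
  have h0 : (∑ j, u j ^ 2) / 2 + (∑ j, (Complex.I * u j) ^ 2) / (4 * (1 / 2)) = 0 := by
    simp only [mul_pow, Complex.I_sq, ← Finset.mul_sum]
    ring
  rw [h0, Complex.exp_zero, mul_one, Complex.ofReal_cpow (by positivity)]
  congr 1
  · push_cast; ring
  · push_cast; rfl

/-- The quadratic part in `x` and `t` is `-(3/2)(x - √2t/3)² - t²/6`. One unit of the first square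
is kept for the averages of `σ`; the remaining half absorbs the term linear in `x` and `Re z`. -/
theorem norm_mul_spectralKernel_mul_shiftedGaussian_le (z : Fin n → ℂ) (t x y : Fin n → ℝ) :
    ‖bargmannKernel z t * spectralKernel t x * shiftedGaussian z t x y‖ ≤
      (Real.pi ^ (-(n : ℝ) / 4) * Real.exp (∑ j, (z j).re ^ 2 / 2) *
        Real.exp (-(1 / 6) * ∑ j, t j ^ 2 + ∑ j, (Real.sqrt 2 * (z j).re / 3) * t j)) *
      (Real.exp (-∑ j, (x j - Real.sqrt 2 * t j / 3) ^ 2) *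
        Real.exp (-(1 / 2) * ∑ j, y j ^ 2 + ∑ j, (z j).im * y j)) := by
  rw [norm_mul, norm_mul, norm_bargmannKernel, norm_spectralKernel, shiftedGaussian,
    Complex.norm_exp]
  simp only [mul_assoc]
  refine mul_le_mul_of_nonneg_left ?_ (by positivity)
  simp only [← Real.exp_add]
  rw [Real.exp_le_exp]
  simp only [Complex.re_sum, Finset.mul_sum, ← Finset.sum_add_distrib, ← Finset.sum_neg_distrib]
  refine Finset.sum_le_sum fun j _ => ?_
  have hs : Real.sqrt 2 ^ 2 = 2 := Real.sq_sqrt (by norm_num)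
  have hre : (((Real.sqrt 2 : ℂ) * t j - x j - z j + Complex.I * y j) ^ 2 / 2).re =
      ((Real.sqrt 2 * t j - x j - (z j).re) ^ 2 - (y j - (z j).im) ^ 2) / 2 := by
    rw [Complex.div_ofNat_re, sq, Complex.mul_re]
    simp
    ring
  rw [hre]
  have h := sq_nonneg (x j - (z j).re - Real.sqrt 2 * t j / 3)
  generalize Real.sqrt 2 = s at *
  have key : (-(1 / 6) * t j ^ 2 + s * (z j).re / 3 * t j + (z j).re ^ 2 / 2 +
      -(x j - s * t j / 3) ^ 2 + (-(1 / 2) * y j ^ 2 + (z j).im * y j)) -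
      (s * t j * (z j).re - t j ^ 2 / 2 - ((z j).re ^ 2 - (z j).im ^ 2) / 2 +
        -(t j - s * x j) ^ 2 + ((s * t j - x j - (z j).re) ^ 2 - (y j - (z j).im) ^ 2) / 2) =
      (x j - (z j).re - s * t j / 3) ^ 2 / 2 := by
    linear_combination (x j ^ 2 - (2 / 3) * t j ^ 2) * hs
  linarith

end TripleIntegral

/-! ### Interchanging the integrals -/

section Fubini

variable {n : ℕ} {σ : Measure (Fin n → ℝ)} [SFinite σ]

/-- In the majorant the `y` integral is a constant, the `x` integral is bounded uniformly in `t` by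
the Gaussian averages centred at `√2t/3`, and the `t` integral pairs two `L₂` functions. -/
theorem integrable_toeplitz_triple (hσ : HasBoundedGaussianAverages σ) {g : (Fin n → ℝ) → ℂ}
    (hg : MemLp g 2) (z : Fin n → ℂ) :
    Integrable (fun p : (Fin n → ℝ) × ((Fin n → ℝ) × (Fin n → ℝ)) =>
      g p.1 * (bargmannKernel z p.1 * spectralKernel p.1 p.2.1 * shiftedGaussian z p.1 p.2.1 p.2.2))
      ((volume : Measure (Fin n → ℝ)).prod (σ.prod volume)) := by
  obtain ⟨C, hC, hbd⟩ := hσ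
  set A : (Fin n → ℝ) → ℝ := fun t => Real.pi ^ (-(n : ℝ) / 4) *
    Real.exp (∑ j, (z j).re ^ 2 / 2) *
      Real.exp (-(1 / 6) * ∑ j, t j ^ 2 + ∑ j, (Real.sqrt 2 * (z j).re / 3) * t j) with hA
  set X : (Fin n → ℝ) → (Fin n → ℝ) → ℝ :=
    fun t x => Real.exp (-∑ j, (x j - Real.sqrt 2 * t j / 3) ^ 2) with hX
  set Y : (Fin n → ℝ) → ℝ :=
    fun y => Real.exp (-(1 / 2) * ∑ j, y j ^ 2 + ∑ j, (z j).im * y j) with hY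
  have hA0 : ∀ t, 0 ≤ A t := fun t => by positivity
  have hAi : Integrable (fun t => ‖g t‖ * A t) volume :=
    hg.norm.integrable_mul ((memLp_exp_quadratic (n := n) (b := 1 / 6) (by norm_num)
      fun j => Real.sqrt 2 * (z j).re / 3).const_mul _)
  have hYi : Integrable Y volume := integrable_exp_quadratic (by norm_num) _
  have hgm := hg.aestronglyMeasurable
  refine ⟨hgm.comp_fst.mul (Continuous.aestronglyMeasurable ?_), ?_⟩
  · unfold bargmannKernel spectralKernel shiftedGaussian; fun_prop
  have hle : ∀ p : (Fin n → ℝ) × ((Fin n → ℝ) × (Fin n → ℝ)),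
      ‖g p.1 * (bargmannKernel z p.1 * spectralKernel p.1 p.2.1 *
        shiftedGaussian z p.1 p.2.1 p.2.2)‖ₑ ≤
      ENNReal.ofReal (‖g p.1‖ * A p.1) *
        (ENNReal.ofReal (X p.1 p.2.1) * ENNReal.ofReal (Y p.2.2)) := by
    rintro ⟨t, x, y⟩
    rw [← ofReal_norm, ← ENNReal.ofReal_mul (Real.exp_nonneg _),
      ← ENNReal.ofReal_mul (mul_nonneg (norm_nonneg _) (hA0 _)), norm_mul,
      mul_assoc ‖g t‖]
    exact ENNReal.ofReal_le_ofReal (mul_le_mul_of_nonneg_left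
      (norm_mul_spectralKernel_mul_shiftedGaussian_le z t x y) (norm_nonneg _))
  have hAm : AEMeasurable (fun t => ENNReal.ofReal (‖g t‖ * A t)) volume :=
    hAi.aestronglyMeasurable.aemeasurable.ennreal_ofReal
  refine (lintegral_mono hle).trans_lt ?_
  have hm : AEMeasurable (fun p : (Fin n → ℝ) × ((Fin n → ℝ) × (Fin n → ℝ)) =>
      ENNReal.ofReal (‖g p.1‖ * A p.1) *
        (ENNReal.ofReal (X p.1 p.2.1) * ENNReal.ofReal (Y p.2.2)))
      ((volume : Measure (Fin n → ℝ)).prod (σ.prod volume)) :=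
    hAm.comp_fst.mul (Measurable.aemeasurable (by fun_prop))
  rw [lintegral_prod _ hm]
  have hinner : ∀ t, ∫⁻ q : (Fin n → ℝ) × (Fin n → ℝ), ENNReal.ofReal (‖g t‖ * A t) *
        (ENNReal.ofReal (X t q.1) * ENNReal.ofReal (Y q.2)) ∂σ.prod volume ≤
      ENNReal.ofReal (‖g t‖ * A t) * (C * ∫⁻ y, ENNReal.ofReal (Y y)) := by
    intro t
    have h := lintegral_prod_mul (μ := σ) (ν := (volume : Measure (Fin n → ℝ)))
      (f := fun x => ENNReal.ofReal (X t x)) (g := fun y => ENNReal.ofReal (Y y))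
      (Measurable.aemeasurable (by fun_prop))
      (Measurable.aemeasurable (by fun_prop))
    rw [lintegral_const_mul _ (by fun_prop), h]
    gcongr
    exact hbd fun j => Real.sqrt 2 * t j / 3
  refine (lintegral_mono hinner).trans_lt ?_
  rw [lintegral_mul_const'' _ hAm]
  exact ENNReal.mul_lt_top hAi.lintegral_lt_top
    (ENNReal.mul_lt_top hC.lt_top hYi.lintegral_lt_top)

theorem integrable_mul_integral_spectralKernel (hσ : HasBoundedGaussianAverages σ)
    {g : (Fin n → ℝ) → ℂ} (hg : MemLp g 2) (z : Fin n → ℂ) :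
    Integrable fun t => g t * bargmannKernel z t * ∫ x, spectralKernel t x ∂σ :=
  (hσ.memLp_integral_spectralKernel).integrable_mul
    (memLp_one_iff_integrable.2 (integrable_mul_bargmannKernel hg z)) |>.congr
      (Filter.Eventually.of_forall fun _ => mul_comm _ _)

theorem integral_toeplitzIntegrand_bargmannIntegral (hσ : HasBoundedGaussianAverages σ)
    {g : (Fin n → ℝ) → ℂ} (hg : MemLp g 2) (z : Fin n → ℂ) :
    ∫ w, toeplitzIntegrand (bargmannIntegral g) z w
        ∂(σ.prod volume).map (realProdEquivComplex n) =
      (((2 * Real.pi) ^ ((n : ℝ) / 2) : ℝ) : ℂ) *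
        ∫ t, g t * bargmannKernel z t * ∫ x, spectralKernel t x ∂σ := by
  have hint := integrable_toeplitz_triple hσ hg z
  have hpt : ∀ q : (Fin n → ℝ) × (Fin n → ℝ),
      toeplitzIntegrand (bargmannIntegral g) z (realProdEquivComplex n q) =
        ∫ t, g t * (bargmannKernel z t * spectralKernel t q.1 * shiftedGaussian z t q.1 q.2) := by
    rintro ⟨x, y⟩
    rw [toeplitzIntegrand, bargmannIntegral_eq, mul_right_comm, ← integral_const_mul]
    refine integral_congr_ae (Filter.Eventually.of_forall fun t => ?_)
    simp only
    rw [← exp_mul_bargmannKernel_mul_exp]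
    ring
  rw [integral_map_equiv]
  simp only [hpt]
  rw [← integral_integral_swap (f := fun t (q : (Fin n → ℝ) × (Fin n → ℝ)) =>
    g t * (bargmannKernel z t * spectralKernel t q.1 * shiftedGaussian z t q.1 q.2)) hint,
    ← integral_const_mul]
  refine integral_congr_ae ?_
  filter_upwards [hint.prod_right_ae] with t ht
  rw [integral_prod _ ht]
  have hy : ∀ x, ∫ y, g t * (bargmannKernel z t * spectralKernel t x * shiftedGaussian z t x y) =
      ((((2 * Real.pi) ^ ((n : ℝ) / 2) : ℝ) : ℂ) * (g t * bargmannKernel z t)) *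
        spectralKernel t x := by
    intro x
    rw [integral_const_mul, integral_const_mul, integral_shiftedGaussian]
    ring
  simp only [hy]
  rw [integral_const_mul, mul_assoc]

end Fubini

/-! ### The multiplication operator and the theorem -/

section Main

variable {n : ℕ} {μ : LocalComplexMeasure (Fin n → ℂ)} {ϱ : LocalComplexMeasure (Fin n → ℝ)}

theorem exists_isMultiplicationBy {φ : (Fin n → ℝ) → ℂ} (hφ : MemLp φ ∞ volume) :
    ∃ M : L2Real n →L[ℂ] L2Real n, IsMultiplicationBy φ M := by
  refine ⟨(ContinuousLinearMap.mul ℂ ℂ).holderL volume ∞ 2 2 hφ.toLp, fun g => ?_⟩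
  filter_upwards [(ContinuousLinearMap.mul ℂ ℂ).coeFn_holder (r := 2) hφ.toLp g,
    hφ.coeFn_toLp] with x h1 h2
  rw [← h2]
  exact h1

theorem inv_pi_pow_mul_rpow :
    ((Real.pi ^ n)⁻¹ : ℂ) * (((2 * Real.pi) ^ ((n : ℝ) / 2) : ℝ) : ℂ) =
      (((2 / Real.pi) ^ ((n : ℝ) / 2) : ℝ) : ℂ) := by
  have hpi := Real.pi_pos
  have h : 2 * Real.pi = 2 / Real.pi * Real.pi ^ (2 : ℝ) := by
    rw [Real.rpow_two]; field_simp
  rw [h, Real.mul_rpow (by positivity) (by positivity), ← Real.rpow_mul hpi.le,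
    mul_div_cancel₀ _ two_ne_zero, Real.rpow_natCast]
  push_cast
  have : (Real.pi : ℂ) ≠ 0 := by exact_mod_cast hpi.ne'
  field_simp

theorem IsTensorLebesgue.integral_toeplitzIntegrand (hμ : IsTensorLebesgue μ ϱ)
    (h₁ : HasBoundedGaussianAverages ϱ.rePos) (h₂ : HasBoundedGaussianAverages ϱ.reNeg)
    (h₃ : HasBoundedGaussianAverages ϱ.imPos) (h₄ : HasBoundedGaussianAverages ϱ.imNeg)
    {g : (Fin n → ℝ) → ℂ} (hg : MemLp g 2) (z : Fin n → ℂ) :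
    ((Real.pi ^ n)⁻¹ : ℂ) * μ.integral (toeplitzIntegrand (bargmannIntegral g) z) =
      bargmannIntegral (fun t => spectralFunction ϱ t * g t) z := by
  rw [LocalComplexMeasure.integral, hμ.re_eq.1, hμ.re_eq.2, hμ.im_eq.1, hμ.im_eq.2,
    integral_toeplitzIntegrand_bargmannIntegral h₁ hg,
    integral_toeplitzIntegrand_bargmannIntegral h₂ hg,
    integral_toeplitzIntegrand_bargmannIntegral h₃ hg,
    integral_toeplitzIntegrand_bargmannIntegral h₄ hg]
  have i₁ := integrable_mul_integral_spectralKernel h₁ hg z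
  have i₂ := integrable_mul_integral_spectralKernel h₂ hg z
  have i₃ := integrable_mul_integral_spectralKernel h₃ hg z
  have i₄ := integrable_mul_integral_spectralKernel h₄ hg z
  have hs := integral_add (i₁.sub i₂) ((i₃.sub i₄).const_mul Complex.I)
  simp only [Pi.sub_apply] at hs
  rw [← mul_sub, ← mul_sub, mul_left_comm Complex.I, ← mul_add, ← mul_assoc, inv_pi_pow_mul_rpow,
    ← integral_sub i₁ i₂, ← integral_sub i₃ i₄, ← integral_const_mul Complex.I,
    ← hs, ← integral_const_mul, bargmannIntegral_eq]
  refine integral_congr_ae (Filter.Eventually.of_forall fun t => ?_)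
  simp only [spectralFunction, LocalComplexMeasure.integral]
  ring

theorem memLp_spectralFunction (h₁ : HasBoundedGaussianAverages ϱ.rePos)
    (h₂ : HasBoundedGaussianAverages ϱ.reNeg) (h₃ : HasBoundedGaussianAverages ϱ.imPos)
    (h₄ : HasBoundedGaussianAverages ϱ.imNeg) : MemLp (spectralFunction ϱ) ∞ volume :=
  ((h₁.memLp_integral_spectralKernel.sub h₂.memLp_integral_spectralKernel).add
    ((h₃.memLp_integral_spectralKernel.sub h₄.memLp_integral_spectralKernel).const_mul
      Complex.I)).const_mul _

/-- On the range of an isometry its adjoint is its inverse. -/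
theorem bargmannAdjoint_coe (U : L2Real n ≃ₗᵢ[ℂ] Fock n) (f : Fock n) :
    bargmannAdjoint U (f : L2Gaussian n) = U.symm f := by
  refine ext_inner_left ℂ fun g => ?_
  rw [bargmannAdjoint, ContinuousLinearMap.adjoint_inner_right,
    ← U.inner_map_map g (U.symm f), U.apply_symm_apply]
  rfl

end Main

end

theorem theorem4p4 (n : ℕ) (ϱ : LocalComplexMeasure (Fin n → ℝ))
    (μ : LocalComplexMeasure (Fin n → ℂ)) (hμ : IsTensorLebesgue μ ϱ) (hFC : IsFockCarleson μ) :
    (∀ x : Fin n → ℝ, Integrable (spectralKernel x) ϱ.variation) ∧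
    MemLp (spectralFunction ϱ) ∞ volume ∧
    ∃ (U : L2Real n ≃ₗᵢ[ℂ] Fock n) (T : Fock n →L[ℂ] Fock n),
      IsBargmann U ∧ IsToeplitz μ T ∧
      IsMultiplicationBy (spectralFunction ϱ)
        (bargmannAdjoint U ∘L (Fock n).subtypeL ∘L T ∘L
          (U.toContinuousLinearEquiv : L2Real n →L[ℂ] Fock n)) ∧
      IsMultiplicationBy (spectralFunction ϱ)
        ((U.symm.toContinuousLinearEquiv : Fock n →L[ℂ] L2Real n) ∘L T ∘L
          (U.toContinuousLinearEquiv : L2Real n →L[ℂ] Fock n)) := by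
  have h₁ : HasBoundedGaussianAverages ϱ.rePos :=
    hFC.hasBoundedGaussianAverages (hμ.re_eq.1 ▸ μ.rePos_le_variation)
  have h₂ : HasBoundedGaussianAverages ϱ.reNeg :=
    hFC.hasBoundedGaussianAverages (hμ.re_eq.2 ▸ μ.reNeg_le_variation)
  have h₃ : HasBoundedGaussianAverages ϱ.imPos :=
    hFC.hasBoundedGaussianAverages (hμ.im_eq.1 ▸ μ.imPos_le_variation)
  have h₄ : HasBoundedGaussianAverages ϱ.imNeg :=
    hFC.hasBoundedGaussianAverages (hμ.im_eq.2 ▸ μ.imNeg_le_variation)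
  have hγ := memLp_spectralFunction h₁ h₂ h₃ h₄
  refine ⟨fun x => ?_, hγ, ?_⟩
  · exact (((h₁.integrable_spectralKernel x).add_measure (h₂.integrable_spectralKernel x)).add_measure
      ((h₃.integrable_spectralKernel x).add_measure (h₄.integrable_spectralKernel x))).mono_measure
        ϱ.variation_le
  obtain ⟨U, hU⟩ := exists_isBargmann (n := n)
  obtain ⟨M, hM⟩ := exists_isMultiplicationBy hγ
  -- Defined as the conjugate of multiplication by `γ_ϱ`, so boundedness is automatic; what remains
  -- is the Toeplitz formula, checked on `f = U g`.
  let T : Fock n →L[ℂ] Fock n := (U.toContinuousLinearEquiv : L2Real n →L[ℂ] Fock n) ∘L M ∘L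
    (U.symm.toContinuousLinearEquiv : Fock n →L[ℂ] L2Real n)
  have hTU : ∀ g, T (U g) = U (M g) := fun g => by
    change U (M (U.symm (U g))) = _
    rw [U.symm_apply_apply]
  refine ⟨U, T, hU, fun f z => ⟨hFC.integrable_toeplitzIntegrand f z, ?_⟩, fun g => ?_, fun g => ?_⟩
  · obtain ⟨g, rfl⟩ := U.surjective f
    have hf : fockEntire (U g) = bargmannIntegral g := funext (hU g)
    rw [hTU, hU, hf, hμ.integral_toeplitzIntegrand h₁ h₂ h₃ h₄ (Lp.memLp g), bargmannIntegral_eq,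
      bargmannIntegral_eq]
    refine integral_congr_ae ?_
    filter_upwards [hM g] with t ht
    rw [ht]
  · have h : (bargmannAdjoint U ∘L (Fock n).subtypeL ∘L T ∘L
        (U.toContinuousLinearEquiv : L2Real n →L[ℂ] Fock n)) g = M g := by
      change bargmannAdjoint U (T (U g) : L2Gaussian n) = M g
      rw [bargmannAdjoint_coe, hTU, U.symm_apply_apply]
    rw [h]
    exact hM g
  · have h : ((U.symm.toContinuousLinearEquiv : Fock n →L[ℂ] L2Real n) ∘L T ∘L
        (U.toContinuousLinearEquiv : L2Real n →L[ℂ] Fock n)) g = M g := by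
      change U.symm (T (U g)) = M g
      rw [hTU, U.symm_apply_apply]
    rw [h]
    exact hM g
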